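/- Let $\mathcal{C}$ and $\mathcal{D}$ be monoidal categories which have reflexive coequalizers (coequalizers of pairs of parallel morphisms with a common section) and whose tensor products preserve reflexive coequalizers in both components. Let $G\colon\mathcal{C}\to\mathcal{D}$ and $R\colon\mathcal{D}\to\mathcal{C}$ be lax monoidal functors that preserve reflexive coequalizers, and let $G\dashv R$ be a monoidal adjunction, i.e. an adjunction whose unit and counit are monoidal natural transformations. Write $\mathrm{lax}_{X,Y}\colon R(X)\otimes R(Y)\to R(X\otimes Y)$ for the lax structure of $R$. Assume that - the projection formula holds for $R$, i.e. for all $A\in\mathcal{C}$, $X\in\mathcal{D}$ the morphisms $$\mathrm{lproj}_{A,X}\colon A\otimes R(X)\xrightarrow{\mathrm{unit}_A\otimes \mathrm{id}} RG(A)\otimes R(X)\xrightarrow{\mathrm{lax}}R(G(A)\otimes X),$$ $$\mathrm{rproj}_{X,A}\colon R(X)\otimes A\xrightarrow{\mathrm{id}\otimes \mathrm{unit}_A} R(X)\otimes RG(A)\xrightarrow{\mathrm{lax}}R(X\otimes G(A))$$ are isomorphisms; - $R$ reflects isomorphisms. Let $\mathcal{Z}(-)$ denote the Drinfeld center, whose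 objects are pairs $(X,c)$ with $c_U\colon X\otimes U\to U\otimes X$ a half-braiding, with braiding $\Psi_{(X,c),(Y,d)}=c_Y$. Then $R$ induces a braided lax monoidal functor $\mathcal{Z}(R)\colon\mathcal{Z}(\mathcal{D})\to\mathcal{Z}(\mathcal{C})$, $(X,c)\mapsto (R(X),c^R)$, where $c^R_A=\mathrm{lproj}_{A,X}^{-1}\circ R(c_{G(A)})\circ \mathrm{rproj}_{X,A}$, with the same lax structure as $R$; in particular $M=R(\mathbb{1})$, the underlying object of $\mathcal{Z}(R)(\mathbb{1})$, is a commutative monoid in $\mathcal{Z}(\mathcal{C})$. A right $M$-module $A$ in $\mathcal{Z}(\mathcal{C})$ with action $\mathrm{act}\colon A\otimes M\to A$ is local if $\mathrm{act}\circ\Psi_{M,A}\circ\Psi_{A,M}=\mathrm{act}$. Local right $M$-modules form a braided monoidal category $\mathrm{mod}^{\mathrm{loc}}_{\mathcal{Z}(\mathcal{C})}\text{-}M$, where $A\otimes_M B$ is the coequalizer in $\mathcal{Z}(\mathcal{C})$ of $$\mathrm{act}_A\otimes B,\quad A\otimes(\mathrm{act}_B\circ\Psi_{M,B})\;\colon\;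 A\otimes M\otimes B\rightrightarrows A\otimes B,$$ with action induced by $\mathrm{act}_B$, unit object $M$, and braiding induced by $\Psi_{A,B}$. Then there is an equivalence of braided monoidal categories $$\mathcal{Z}(\mathcal{D})\;\simeq\;\mathrm{mod}^{\mathrm{loc}}_{\mathcal{Z}(\mathcal{C})}\text{-}M .$$ -/

import Mathlib

open CategoryTheory MonoidalCategory Limits

set_option linter.unusedSectionVars false

universe v₁ v₂ u₁ u₂

namespace MonoidalMonadicity

section Coequalizers

variable {C : Type u₁} [Category.{v₁} C] {D : Type u₂} [Category.{v₂} D]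

/-- A functor preserves reflexive coequalizers if it preserves the coequalizer of every
reflexive pair. -/
class PreservesReflexiveCoequalizers (F : C ⥤ D) : Prop where
  out : ∀ ⦃A B : C⦄ (f g : A ⟶ B) [IsReflexivePair f g], PreservesColimit (parallelPair f g) F

/-- Elementwise form of the statement that `q` is a coequalizer of `f` and `g`. -/
structure IsCoeq {A B Q : C} (f g : A ⟶ B) (q : B ⟶ Q) : Prop where
  w : f ≫ q = g ≫ q
  existsUnique : ∀ ⦃Z : C⦄ (h : B ⟶ Z), f ≫ h = g ≫ h → ∃! d : Q ⟶ Z, q ≫ d = h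

namespace IsCoeq

variable {A B Q : C} {f g : A ⟶ B} {q : B ⟶ Q}

theorem epi (hq : IsCoeq f g q) : Epi q where
  left_cancellation {Z} a b hab :=
    (hq.existsUnique (q ≫ a) (by rw [← Category.assoc, hq.w, Category.assoc])).unique rfl hab.symm

/-- The morphism out of a coequalizer given by its universal property. -/
noncomputable def desc (hq : IsCoeq f g q) {Z : C} (h : B ⟶ Z) (w : f ≫ h = g ≫ h) : Q ⟶ Z :=
  (hq.existsUnique h w).choose

theorem fac (hq : IsCoeq f g q) {Z : C} (h : B ⟶ Z) (w : f ≫ h = g ≫ h) : q ≫ hq.desc h w = h :=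
  (hq.existsUnique h w).choose_spec.1

theorem of_isColimit (w : f ≫ q = g ≫ q) (h : IsColimit (Cofork.ofπ q w)) : IsCoeq f g q where
  w := w
  existsUnique _ k hk :=
    ⟨Cofork.IsColimit.desc h k hk, Cofork.IsColimit.π_desc' h k hk, fun _ hd =>
      Cofork.IsColimit.hom_ext h (hd.trans (Cofork.IsColimit.π_desc' h k hk).symm)⟩

/-- A coequalizer in the elementwise sense is a colimit cofork. -/
noncomputable def isColimit (hq : IsCoeq f g q) : IsColimit (Cofork.ofπ q hq.w) :=
  Cofork.IsColimit.mk _ (fun s => hq.desc s.π s.condition) (fun s => hq.fac _ _)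
    (fun s m hm => by
      have := hq.epi
      rw [← cancel_epi q, hq.fac]
      exact hm)

theorem of_coequalizer (f g : A ⟶ B) [HasCoequalizer f g] :
    IsCoeq f g (coequalizer.π f g) :=
  of_isColimit (coequalizer.condition f g) (coequalizerIsCoequalizer f g)

theorem map [IsReflexivePair f g] (hq : IsCoeq f g q) (F : C ⥤ D)
    [PreservesReflexiveCoequalizers F] : IsCoeq (F.map f) (F.map g) (F.map q) := by
  have := PreservesReflexiveCoequalizers.out (F := F) f g
  exact of_isColimit _ (isColimitCoforkMapOfIsColimit F hq.w hq.isColimit)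

end IsCoeq

theorem preserves_of_isCoeq (F : C ⥤ D)
    (h : ∀ ⦃A B Q : C⦄ (f g : A ⟶ B) (q : B ⟶ Q) [IsReflexivePair f g],
      IsCoeq f g q → IsCoeq (F.map f) (F.map g) (F.map q)) :
    PreservesReflexiveCoequalizers F where
  out A B f g _ :=
    ⟨fun {c} hc => by
      have e : Cofork.ofπ (Cofork.π c) (Cofork.condition c) ≅ c := (Cofork.isoCoforkOfπ c).symm
      have h1 := IsCoeq.of_isColimit (Cofork.condition c)
        (IsColimit.ofIsoColimit hc e.symm)
      have h2 := (h f g _ h1).isColimit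
      exact ⟨IsColimit.ofIsoColimit ((isColimitMapCoconeCoforkEquiv F h1.w).symm h2)
        ((Cocone.functoriality _ F).mapIso e)⟩⟩

end Coequalizers

/-- A monoidal category which has reflexive coequalizers and whose tensor product preserves them
in both components. -/
class ReflexiveMonoidal (C : Type u₁) [Category.{v₁} C] [MonoidalCategory C] : Prop where
  hasReflexiveCoequalizers : HasReflexiveCoequalizers C
  preserves_tensorLeft : ∀ X : C, PreservesReflexiveCoequalizers (tensorLeft X)
  preserves_tensorRight : ∀ X : C, PreservesReflexiveCoequalizers (tensorRight X)

attribute [instance] ReflexiveMonoidal.hasReflexiveCoequalizers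
  ReflexiveMonoidal.preserves_tensorLeft ReflexiveMonoidal.preserves_tensorRight

theorem IsCoeq.whiskerLeft {C : Type u₁} [Category.{v₁} C] [MonoidalCategory C]
    [ReflexiveMonoidal C] {A B Q : C} {f g : A ⟶ B} {q : B ⟶ Q} [IsReflexivePair f g]
    (hq : IsCoeq f g q) (Z : C) : IsCoeq (Z ◁ f) (Z ◁ g) (Z ◁ q) :=
  hq.map (tensorLeft Z)

theorem IsCoeq.whiskerRight {C : Type u₁} [Category.{v₁} C] [MonoidalCategory C]
    [ReflexiveMonoidal C] {A B Q : C} {f g : A ⟶ B} {q : B ⟶ Q} [IsReflexivePair f g]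
    (hq : IsCoeq f g q) (Z : C) : IsCoeq (f ▷ Z) (g ▷ Z) (q ▷ Z) :=
  hq.map (tensorRight Z)

instance isReflexivePair_whiskerRight {C : Type u₁} [Category.{v₁} C] [MonoidalCategory C]
    {A B : C} (f g : A ⟶ B) [IsReflexivePair f g] (Z : C) : IsReflexivePair (f ▷ Z) (g ▷ Z) :=
  IsReflexivePair.mk' (commonSection f g ▷ Z) (by simp [← comp_whiskerRight])
    (by simp [← comp_whiskerRight])

instance isReflexivePair_whiskerLeft {C : Type u₁} [Category.{v₁} C] [MonoidalCategory C]
    {A B : C} (f g : A ⟶ B) [IsReflexivePair f g] (Z : C) : IsReflexivePair (Z ◁ f) (Z ◁ g) :=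
  IsReflexivePair.mk' (Z ◁ commonSection f g) (by simp [← MonoidalCategory.whiskerLeft_comp])
    (by simp [← MonoidalCategory.whiskerLeft_comp])

section RightModules

open scoped MonObj

variable {B : Type u₁} [Category.{v₁} B] [MonoidalCategory B]

/-- A right module over a monoid object `M` of a monoidal category. -/
structure RMod (M : B) [MonObj M] where
  X : B
  act : X ⊗ M ⟶ X
  act_one : X ◁ η[M] ≫ act = (ρ_ X).hom
  act_act : act ▷ M ≫ act = (α_ X M M).hom ≫ X ◁ μ[M] ≫ act

namespace RMod

variable {M : B} [MonObj M]

attribute [simp] act_one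

/-- A morphism of right modules. -/
@[ext]
structure Hom (X Y : RMod M) where
  hom : X.X ⟶ Y.X
  comm : X.act ≫ hom = hom ▷ M ≫ Y.act


instance : Category (RMod M) where
  Hom := Hom
  id X := ⟨𝟙 X.X, by simp⟩
  comp f g := ⟨f.hom ≫ g.hom, by
    rw [← Category.assoc, f.comm, Category.assoc, g.comm, comp_whiskerRight, Category.assoc]⟩

@[ext]
theorem hom_ext {X Y : RMod M} (f g : X ⟶ Y) (h : f.hom = g.hom) : f = g := Hom.ext h

@[simp] theorem id_hom (X : RMod M) : Hom.hom (𝟙 X) = 𝟙 X.X := rfl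

@[simp] theorem comp_hom {X Y Z : RMod M} (f : X ⟶ Y) (g : Y ⟶ Z) :
    (f ≫ g).hom = f.hom ≫ g.hom := rfl

/-- An isomorphism of right modules from mutually inverse morphisms, one of which is linear. -/
@[simps]
def isoMk {X Y : RMod M} (f : X ⟶ Y) (g : Y.X ⟶ X.X) (h₁ : f.hom ≫ g = 𝟙 _)
    (h₂ : g ≫ f.hom = 𝟙 _) : X ≅ Y where
  hom := f
  inv := ⟨g, by
    have : Y.act = g ▷ M ≫ X.act ≫ f.hom := by
      rw [f.comm, ← comp_whiskerRight_assoc, h₂]; simp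
    rw [this]; simp [h₁]⟩
  hom_inv_id := by ext; exact h₁
  inv_hom_id := by ext; exact h₂

/-- The monoid as a right module over itself. -/
@[simps]
def unit (M : B) [MonObj M] : RMod M where
  X := M
  act := μ[M]
  act_one := by simp
  act_act := by simp

variable [BraidedCategory B]

/-- The left action of `M` on a right module obtained from the braiding. -/
def lact (Y : RMod M) : M ⊗ Y.X ⟶ Y.X := (β_ M Y.X).hom ≫ Y.act

theorem one_lact (Y : RMod M) : η[M] ▷ Y.X ≫ Y.lact = (λ_ Y.X).hom := by
  simp [lact]

theorem lact_natural {X Y : RMod M} (f : X ⟶ Y) : X.lact ≫ f.hom = M ◁ f.hom ≫ Y.lact := by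
  simp [lact, f.comm]

section Comm

variable [IsCommMonObj M]

theorem lact_act (Y : RMod M) :
    Y.lact ▷ M ≫ Y.act = (α_ M Y.X M).hom ≫ M ◁ Y.act ≫ Y.lact := by
  simp only [lact, comp_whiskerRight, Category.assoc, act_act,
    BraidedCategory.braiding_naturality_right_assoc, BraidedCategory.braiding_tensor_right_hom]
  simp [← MonoidalCategory.whiskerLeft_comp_assoc, IsCommMonObj.mul_comm]

theorem mul_lact (Y : RMod M) :
    μ[M] ▷ Y.X ≫ Y.lact = (α_ M M Y.X).hom ≫ M ◁ Y.lact ≫ Y.lact := by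
  have h : M ◁ Y.lact ≫ Y.lact =
      M ◁ (β_ M Y.X).hom ≫ (α_ _ _ _).inv ≫ Y.lact ▷ M ≫ Y.act := by
    rw [lact_act]; simp [lact]
  rw [h]
  simp only [lact, comp_whiskerRight, Category.assoc, act_act,
    BraidedCategory.braiding_naturality_left_assoc, BraidedCategory.braiding_tensor_left_hom]

end Comm

variable [ReflexiveMonoidal B]

/-- The two parallel morphisms whose coequalizer is the relative tensor product. -/
def pairL (X Y : RMod M) : (X.X ⊗ M) ⊗ Y.X ⟶ X.X ⊗ Y.X := X.act ▷ Y.X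

/-- The second of the two parallel morphisms. -/
def pairR (X Y : RMod M) : (X.X ⊗ M) ⊗ Y.X ⟶ X.X ⊗ Y.X :=
  (α_ X.X M Y.X).hom ≫ X.X ◁ Y.lact

instance (X Y : RMod M) : IsReflexivePair (pairL X Y) (pairR X Y) :=
  IsReflexivePair.mk' ((ρ_ X.X).inv ▷ Y.X ≫ (X.X ◁ η[M]) ▷ Y.X)
    (by simp only [pairL, ← comp_whiskerRight, Category.assoc, act_one]; simp)
    (by simp [pairR, ← MonoidalCategory.whiskerLeft_comp, one_lact])

/-- The underlying object of the tensor product over `M`. -/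
noncomputable def tens (X Y : RMod M) : B := coequalizer (pairL X Y) (pairR X Y)

/-- The projection onto the relative tensor product. -/
noncomputable def tensπ (X Y : RMod M) : X.X ⊗ Y.X ⟶ tens X Y :=
  coequalizer.π (pairL X Y) (pairR X Y)

theorem isCoeq_tensπ (X Y : RMod M) : IsCoeq (pairL X Y) (pairR X Y) (tensπ X Y) :=
  IsCoeq.of_coequalizer _ _

theorem act_tensπ (X Y : RMod M) :
    X.act ▷ Y.X ≫ tensπ X Y = (α_ X.X M Y.X).hom ≫ X.X ◁ Y.lact ≫ tensπ X Y := by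
  simpa [pairL, pairR] using (isCoeq_tensπ X Y).w

variable [IsCommMonObj M]

theorem tensAct_aux (X Y : RMod M) :
    pairL X Y ▷ M ≫ (α_ X.X Y.X M).hom ≫ X.X ◁ Y.act ≫ tensπ X Y =
      pairR X Y ▷ M ≫ (α_ X.X Y.X M).hom ≫ X.X ◁ Y.act ≫ tensπ X Y := by
  have h : pairR X Y ▷ M ≫ (α_ X.X Y.X M).hom ≫ X.X ◁ Y.act =
      ((α_ _ _ _).hom ▷ M ≫ (α_ _ _ _).hom) ≫ X.X ◁ (Y.lact ▷ M ≫ Y.act) := by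
    simp [pairR]
  rw [reassoc_of% h, lact_act]
  simp only [pairL, associator_naturality_left_assoc, ← whisker_exchange_assoc, act_tensπ]
  monoidal

/-- The action on the relative tensor product, induced by that on the second factor. -/
noncomputable def tensAct (X Y : RMod M) : tens X Y ⊗ M ⟶ tens X Y :=
  ((isCoeq_tensπ X Y).whiskerRight M).desc ((α_ _ _ _).hom ≫ X.X ◁ Y.act ≫ tensπ X Y)
    (tensAct_aux X Y)

theorem tensπ_tensAct (X Y : RMod M) :
    tensπ X Y ▷ M ≫ tensAct X Y = (α_ _ _ _).hom ≫ X.X ◁ Y.act ≫ tensπ X Y :=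
  ((isCoeq_tensπ X Y).whiskerRight M).fac _ _

/-- The tensor product over `M` of two right modules. -/
noncomputable def tensorObj (X Y : RMod M) : RMod M where
  X := tens X Y
  act := tensAct X Y
  act_one := by
    have := ((isCoeq_tensπ X Y).whiskerRight (𝟙_ B)).epi
    refine (cancel_epi (tensπ X Y ▷ 𝟙_ B)).1 ?_
    rw [← whisker_exchange_assoc, tensπ_tensAct]
    simp [← MonoidalCategory.whiskerLeft_comp_assoc]
  act_act := by
    have := (((isCoeq_tensπ X Y).whiskerRight M).whiskerRight M).epi
    refine (cancel_epi (tensπ X Y ▷ M ▷ M)).1 ?_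
    rw [← comp_whiskerRight_assoc, tensπ_tensAct]
    simp only [comp_whiskerRight, Category.assoc, tensπ_tensAct,
      associator_naturality_left_assoc, ← whisker_exchange_assoc]
    have h := congrArg (fun t => X.X ◁ t) Y.act_act
    simp only [MonoidalCategory.whiskerLeft_comp] at h
    rw [associator_naturality_middle_assoc, reassoc_of% h]
    monoidal

/-- The quotient morphism onto the tensor product over `M`. -/
noncomputable def quo (X Y : RMod M) : X.X ⊗ Y.X ⟶ (tensorObj X Y).X := tensπ X Y

theorem isCoeq_quo (X Y : RMod M) : IsCoeq (pairL X Y) (pairR X Y) (quo X Y) :=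
  isCoeq_tensπ X Y

theorem act_quo (X Y : RMod M) :
    X.act ▷ Y.X ≫ quo X Y = (α_ X.X M Y.X).hom ≫ X.X ◁ Y.lact ≫ quo X Y :=
  act_tensπ X Y

theorem quo_act (X Y : RMod M) :
    quo X Y ▷ M ≫ (tensorObj X Y).act = (α_ _ _ _).hom ≫ X.X ◁ Y.act ≫ quo X Y :=
  tensπ_tensAct X Y

instance (X Y : RMod M) : Epi (quo X Y) := (isCoeq_quo X Y).epi
instance (X Y : RMod M) (Z : B) : Epi (quo X Y ▷ Z) := ((isCoeq_quo X Y).whiskerRight Z).epi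
instance (X Y : RMod M) (Z : B) : Epi (Z ◁ quo X Y) := ((isCoeq_quo X Y).whiskerLeft Z).epi
instance (X Y : RMod M) (Z W : B) : Epi (quo X Y ▷ Z ▷ W) :=
  (((isCoeq_quo X Y).whiskerRight Z).whiskerRight W).epi

theorem quo_lact (X Y : RMod M) :
    M ◁ quo X Y ≫ (tensorObj X Y).lact = (α_ _ _ _).inv ≫ X.lact ▷ Y.X ≫ quo X Y := by
  simp only [lact, BraidedCategory.braiding_naturality_right_assoc, quo_act, comp_whiskerRight,
    Category.assoc, act_quo, BraidedCategory.braiding_tensor_right_hom]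
  simp

/-- The morphism out of a tensor product of modules induced by a balanced linear morphism. -/
noncomputable def descHom (X Y Z : RMod M) (h : X.X ⊗ Y.X ⟶ Z.X)
    (w : X.act ▷ Y.X ≫ h = (α_ X.X M Y.X).hom ≫ X.X ◁ Y.lact ≫ h)
    (l : (α_ _ _ _).hom ≫ X.X ◁ Y.act ≫ h = h ▷ M ≫ Z.act) : tensorObj X Y ⟶ Z where
  hom := (isCoeq_quo X Y).desc h (by simpa [pairL, pairR] using w)
  comm := by
    rw [← cancel_epi (quo X Y ▷ M), reassoc_of% quo_act, (isCoeq_quo X Y).fac,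
      ← comp_whiskerRight_assoc, (isCoeq_quo X Y).fac, l]

theorem quo_descHom (X Y Z : RMod M) (h : X.X ⊗ Y.X ⟶ Z.X)
    (w : X.act ▷ Y.X ≫ h = (α_ X.X M Y.X).hom ≫ X.X ◁ Y.lact ≫ h)
    (l : (α_ _ _ _).hom ≫ X.X ◁ Y.act ≫ h = h ▷ M ≫ Z.act) :
    quo X Y ≫ (descHom X Y Z h w l).hom = h :=
  (isCoeq_quo X Y).fac h (by simpa [pairL, pairR] using w)

/-- The tensor product over `M` of two morphisms of modules. -/
noncomputable def tensorHom {X Y X' Y' : RMod M} (f : X ⟶ X') (g : Y ⟶ Y') :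
    tensorObj X Y ⟶ tensorObj X' Y' :=
  descHom X Y _ ((f.hom ⊗ₘ g.hom) ≫ quo X' Y')
    (by
      have h := congrArg (fun t => X'.X ◁ t) (lact_natural g)
      simp only [MonoidalCategory.whiskerLeft_comp] at h
      simp only [MonoidalCategory.tensorHom_def, Category.assoc]
      rw [← comp_whiskerRight_assoc, f.comm, comp_whiskerRight_assoc, ← whisker_exchange_assoc,
        act_quo, whisker_exchange_assoc, reassoc_of% h]
      monoidal)
    (by
      have h := congrArg (fun t => X'.X ◁ t) g.comm
      simp only [MonoidalCategory.whiskerLeft_comp] at h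
      simp only [MonoidalCategory.tensorHom_def, Category.assoc]
      rw [whisker_exchange_assoc, reassoc_of% h, comp_whiskerRight_assoc,
        comp_whiskerRight_assoc, quo_act]
      monoidal)

theorem quo_tensorHom {X Y X' Y' : RMod M} (f : X ⟶ X') (g : Y ⟶ Y') :
    quo X Y ≫ (tensorHom f g).hom = (f.hom ⊗ₘ g.hom) ≫ quo X' Y' :=
  quo_descHom _ _ _ _ _ _

theorem assocAux₁_w (X Y Z : RMod M) :
    pairL X Y ▷ Z.X ≫ (α_ _ _ _).hom ≫ X.X ◁ quo Y Z ≫ quo X (tensorObj Y Z) =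
      pairR X Y ▷ Z.X ≫ (α_ _ _ _).hom ≫ X.X ◁ quo Y Z ≫ quo X (tensorObj Y Z) := by
  have h := congrArg (fun t => X.X ◁ t) (quo_lact Y Z)
  simp only [MonoidalCategory.whiskerLeft_comp] at h
  simp only [pairL, pairR, associator_naturality_left_assoc]
  rw [← whisker_exchange_assoc, act_quo, associator_naturality_right_assoc, reassoc_of% h]
  monoidal

/-- First step in the construction of the associator. -/
noncomputable def assocAux₁ (X Y Z : RMod M) :
    (tensorObj X Y).X ⊗ Z.X ⟶ (tensorObj X (tensorObj Y Z)).X :=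
  ((isCoeq_quo X Y).whiskerRight Z.X).desc
    ((α_ _ _ _).hom ≫ X.X ◁ quo Y Z ≫ quo X (tensorObj Y Z)) (assocAux₁_w X Y Z)

theorem quo_assocAux₁ (X Y Z : RMod M) :
    quo X Y ▷ Z.X ≫ assocAux₁ X Y Z =
      (α_ _ _ _).hom ≫ X.X ◁ quo Y Z ≫ quo X (tensorObj Y Z) :=
  ((isCoeq_quo X Y).whiskerRight Z.X).fac _ (assocAux₁_w X Y Z)

/-- The associator, as a morphism of modules. -/
noncomputable def assocHom (X Y Z : RMod M) :
    tensorObj (tensorObj X Y) Z ⟶ tensorObj X (tensorObj Y Z) :=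
  descHom _ _ _ (assocAux₁ X Y Z)
    (by
      have h := congrArg (fun t => X.X ◁ t) (act_quo Y Z)
      simp only [MonoidalCategory.whiskerLeft_comp] at h
      refine (cancel_epi (quo X Y ▷ M ▷ Z.X)).1 ?_
      rw [← comp_whiskerRight_assoc, quo_act, associator_naturality_left_assoc,
        ← whisker_exchange_assoc, quo_assocAux₁]
      simp only [comp_whiskerRight, Category.assoc, quo_assocAux₁]
      rw [associator_naturality_middle_assoc, reassoc_of% h]
      monoidal)
    (by
      have h := congrArg (fun t => X.X ◁ t) (quo_act Y Z)
      simp only [MonoidalCategory.whiskerLeft_comp] at h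
      refine (cancel_epi (quo X Y ▷ Z.X ▷ M)).1 ?_
      rw [← comp_whiskerRight_assoc, quo_assocAux₁, associator_naturality_left_assoc,
        ← whisker_exchange_assoc, quo_assocAux₁]
      simp only [comp_whiskerRight, Category.assoc, quo_act]
      rw [associator_naturality_middle_assoc, reassoc_of% h]
      monoidal)

theorem quo_assocHom (X Y Z : RMod M) :
    quo X Y ▷ Z.X ≫ quo (tensorObj X Y) Z ≫ (assocHom X Y Z).hom =
      (α_ _ _ _).hom ≫ X.X ◁ quo Y Z ≫ quo X (tensorObj Y Z) := by
  rw [assocHom, quo_descHom, quo_assocAux₁]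

theorem assocAux₂_w (X Y Z : RMod M) :
    X.X ◁ pairL Y Z ≫ (α_ _ _ _).inv ≫ quo X Y ▷ Z.X ≫ quo (tensorObj X Y) Z =
      X.X ◁ pairR Y Z ≫ (α_ _ _ _).inv ≫ quo X Y ▷ Z.X ≫ quo (tensorObj X Y) Z := by
  have h : X.X ◁ Y.act ≫ quo X Y = (α_ _ _ _).inv ≫ quo X Y ▷ M ≫ (tensorObj X Y).act := by
    rw [quo_act]; simp
  have h' := congrArg (fun t => t ▷ Z.X) h
  simp only [comp_whiskerRight] at h'
  simp only [pairL, pairR, associator_inv_naturality_middle_assoc]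
  rw [reassoc_of% h', act_quo, associator_naturality_left_assoc, ← whisker_exchange_assoc]
  monoidal

/-- First step in the construction of the inverse of the associator. -/
noncomputable def assocAux₂ (X Y Z : RMod M) :
    X.X ⊗ (tensorObj Y Z).X ⟶ (tensorObj (tensorObj X Y) Z).X :=
  ((isCoeq_quo Y Z).whiskerLeft X.X).desc
    ((α_ _ _ _).inv ≫ quo X Y ▷ Z.X ≫ quo (tensorObj X Y) Z) (assocAux₂_w X Y Z)

theorem quo_assocAux₂ (X Y Z : RMod M) :
    X.X ◁ quo Y Z ≫ assocAux₂ X Y Z =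
      (α_ _ _ _).inv ≫ quo X Y ▷ Z.X ≫ quo (tensorObj X Y) Z :=
  ((isCoeq_quo Y Z).whiskerLeft X.X).fac _ (assocAux₂_w X Y Z)

theorem assocInv_w (X Y Z : RMod M) :
    pairL X (tensorObj Y Z) ≫ assocAux₂ X Y Z = pairR X (tensorObj Y Z) ≫ assocAux₂ X Y Z := by
  have h := congrArg (fun t => X.X ◁ t) (quo_lact Y Z)
  simp only [MonoidalCategory.whiskerLeft_comp] at h
  have h' := congrArg (fun t => t ▷ Z.X) (act_quo X Y)
  simp only [comp_whiskerRight] at h'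
  refine (cancel_epi ((X.X ⊗ M) ◁ quo Y Z)).1 ?_
  simp only [pairL, pairR, Category.assoc]
  rw [whisker_exchange_assoc, quo_assocAux₂, associator_naturality_right_assoc, reassoc_of% h,
    quo_assocAux₂, associator_inv_naturality_left_assoc, reassoc_of% h']
  monoidal

/-- The inverse of the associator. -/
noncomputable def assocInv (X Y Z : RMod M) :
    (tensorObj X (tensorObj Y Z)).X ⟶ (tensorObj (tensorObj X Y) Z).X :=
  (isCoeq_quo X (tensorObj Y Z)).desc (assocAux₂ X Y Z) (assocInv_w X Y Z)

theorem quo_assocInv (X Y Z : RMod M) :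
    X.X ◁ quo Y Z ≫ quo X (tensorObj Y Z) ≫ assocInv X Y Z =
      (α_ _ _ _).inv ≫ quo X Y ▷ Z.X ≫ quo (tensorObj X Y) Z := by
  rw [assocInv, (isCoeq_quo X (tensorObj Y Z)).fac, quo_assocAux₂]

/-- The associativity isomorphism of the tensor product over `M`. -/
noncomputable def associator (X Y Z : RMod M) :
    tensorObj (tensorObj X Y) Z ≅ tensorObj X (tensorObj Y Z) :=
  isoMk (assocHom X Y Z) (assocInv X Y Z)
    (by
      refine (cancel_epi (quo (tensorObj X Y) Z)).1 ((cancel_epi (quo X Y ▷ Z.X)).1 ?_)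
      rw [reassoc_of% quo_assocHom, quo_assocInv]
      simp)
    (by
      refine (cancel_epi (quo X (tensorObj Y Z))).1 ((cancel_epi (X.X ◁ quo Y Z)).1 ?_)
      rw [reassoc_of% quo_assocInv, quo_assocHom]
      simp)

theorem quo_associator (X Y Z : RMod M) :
    quo X Y ▷ Z.X ≫ quo (tensorObj X Y) Z ≫ (associator X Y Z).hom.hom =
      (α_ _ _ _).hom ≫ X.X ◁ quo Y Z ≫ quo X (tensorObj Y Z) :=
  quo_assocHom X Y Z

theorem leftUnitor_aux (X : RMod M) {W : B} (q : M ⊗ X.X ⟶ W)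
    (h : μ[M] ▷ X.X ≫ q = (α_ _ _ _).hom ≫ M ◁ X.lact ≫ q) :
    X.lact ≫ (λ_ X.X).inv ≫ η[M] ▷ X.X ≫ q = q := by
  have h' : M ◁ X.lact ≫ q = (α_ _ _ _).inv ≫ μ[M] ▷ X.X ≫ q := by rw [h]; simp
  rw [leftUnitor_inv_naturality_assoc, whisker_exchange_assoc, h',
    associator_inv_naturality_left_assoc, ← comp_whiskerRight_assoc, MonObj.one_mul]
  monoidal

theorem rightUnitor_aux (X : RMod M) {W : B} (q : X.X ⊗ M ⟶ W)
    (h : X.act ▷ M ≫ q = (α_ _ _ _).hom ≫ X.X ◁ μ[M] ≫ q) :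
    X.act ≫ (ρ_ X.X).inv ≫ X.X ◁ η[M] ≫ q = q := by
  rw [rightUnitor_inv_naturality_assoc, ← whisker_exchange_assoc, h,
    associator_naturality_right_assoc, ← MonoidalCategory.whiskerLeft_comp_assoc, MonObj.mul_one]
  monoidal

variable (M) in
/-- The unit of the monoid, with target the underlying object of the unit module. -/
def unitη : 𝟙_ B ⟶ (unit M).X := η[M]

theorem lact_unit : (unit M).lact = μ[M] := IsCommMonObj.mul_comm M

/-- The left unit constraint, as a morphism of modules. -/
noncomputable def leftUnitorHom (X : RMod M) : tensorObj (unit M) X ⟶ X :=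
  descHom (unit M) X X X.lact (mul_lact X) (lact_act X).symm

theorem quo_leftUnitorHom (X : RMod M) : quo (unit M) X ≫ (leftUnitorHom X).hom = X.lact :=
  quo_descHom (unit M) X X X.lact (mul_lact X) (lact_act X).symm

/-- The left unit isomorphism of the tensor product over `M`. -/
noncomputable def leftUnitor (X : RMod M) : tensorObj (unit M) X ≅ X :=
  isoMk (leftUnitorHom X)
    ((λ_ X.X).inv ≫ unitη M ▷ X.X ≫ quo (unit M) X)
    (by
      refine (cancel_epi (quo (unit M) X)).1 ?_
      rw [← Category.assoc (quo (unit M) X), quo_leftUnitorHom]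
      exact (leftUnitor_aux X _ (act_quo (unit M) X)).trans (Category.comp_id _).symm)
    (by
      have h : unitη M ▷ X.X ≫ quo (unit M) X ≫ (leftUnitorHom X).hom =
          (λ_ X.X).hom := by
        rw [quo_leftUnitorHom]; exact one_lact X
      exact (Category.assoc _ _ _).trans ((Iso.inv_comp_eq _).2
        ((Category.assoc _ _ _).trans (h.trans (Category.comp_id _).symm))))

theorem quo_leftUnitor (X : RMod M) :
    quo (unit M) X ≫ (leftUnitor X).hom.hom = X.lact :=
  quo_leftUnitorHom X

theorem rightUnitor_w (X : RMod M) :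
    X.act ▷ M ≫ X.act = (α_ _ _ _).hom ≫ X.X ◁ (unit M).lact ≫ X.act := by
  rw [lact_unit]; exact X.act_act

/-- The right unit constraint, as a morphism of modules. -/
noncomputable def rightUnitorHom (X : RMod M) : tensorObj X (unit M) ⟶ X :=
  descHom X (unit M) X X.act (rightUnitor_w X) X.act_act.symm

theorem quo_rightUnitorHom (X : RMod M) : quo X (unit M) ≫ (rightUnitorHom X).hom = X.act :=
  quo_descHom X (unit M) X X.act (rightUnitor_w X) X.act_act.symm

/-- The right unit isomorphism of the tensor product over `M`. -/
noncomputable def rightUnitor (X : RMod M) : tensorObj X (unit M) ≅ X :=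
  isoMk (rightUnitorHom X)
    ((ρ_ X.X).inv ≫ X.X ◁ unitη M ≫ quo X (unit M))
    (by
      refine (cancel_epi (quo X (unit M))).1 ?_
      rw [← Category.assoc (quo X (unit M)), quo_rightUnitorHom]
      have h := act_quo X (unit M)
      rw [lact_unit] at h
      exact (rightUnitor_aux X _ h).trans (Category.comp_id _).symm)
    (by
      have h : X.X ◁ unitη M ≫ quo X (unit M) ≫ (rightUnitorHom X).hom =
          (ρ_ X.X).hom := by
        rw [quo_rightUnitorHom]; exact act_one X
      exact (Category.assoc _ _ _).trans ((Iso.inv_comp_eq _).2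
        ((Category.assoc _ _ _).trans (h.trans (Category.comp_id _).symm))))

theorem quo_rightUnitor (X : RMod M) :
    quo X (unit M) ≫ (rightUnitor X).hom.hom = X.act :=
  quo_rightUnitorHom X

noncomputable instance : MonoidalCategoryStruct (RMod M) where
  tensorObj := tensorObj
  whiskerLeft X _ _ f := tensorHom (𝟙 X) f
  whiskerRight f Y := tensorHom f (𝟙 Y)
  tensorHom := tensorHom
  tensorUnit := unit M
  associator := associator
  leftUnitor := leftUnitor
  rightUnitor := rightUnitor

theorem tensorHom_id_id (X Y : RMod M) : tensorHom (𝟙 X) (𝟙 Y) = 𝟙 (tensorObj X Y) := by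
  ext
  refine (cancel_epi (quo X Y)).1 ?_
  rw [quo_tensorHom]
  simp

theorem tensorHom_comp {X₁ Y₁ Z₁ X₂ Y₂ Z₂ : RMod M} (f₁ : X₁ ⟶ Y₁) (f₂ : X₂ ⟶ Y₂)
    (g₁ : Y₁ ⟶ Z₁) (g₂ : Y₂ ⟶ Z₂) :
    tensorHom f₁ f₂ ≫ tensorHom g₁ g₂ = tensorHom (f₁ ≫ g₁) (f₂ ≫ g₂) := by
  ext
  refine (cancel_epi (quo X₁ X₂)).1 ?_
  rw [quo_tensorHom, comp_hom, reassoc_of% quo_tensorHom, quo_tensorHom]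
  simp

theorem assoc_naturality {X₁ X₂ X₃ Y₁ Y₂ Y₃ : RMod M} (f₁ : X₁ ⟶ Y₁) (f₂ : X₂ ⟶ Y₂)
    (f₃ : X₃ ⟶ Y₃) :
    tensorHom (tensorHom f₁ f₂) f₃ ≫ (associator Y₁ Y₂ Y₃).hom =
      (associator X₁ X₂ X₃).hom ≫ tensorHom f₁ (tensorHom f₂ f₃) := by
  ext
  refine (cancel_epi (quo (tensorObj X₁ X₂) X₃)).1 ((cancel_epi (quo X₁ X₂ ▷ X₃.X)).1 ?_)
  rw [comp_hom, comp_hom, reassoc_of% quo_tensorHom, reassoc_of% quo_associator, quo_tensorHom]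
  have h1 : quo X₁ X₂ ▷ X₃.X ≫ ((tensorHom f₁ f₂).hom ⊗ₘ f₃.hom) =
      ((f₁.hom ⊗ₘ f₂.hom) ⊗ₘ f₃.hom) ≫ quo Y₁ Y₂ ▷ Y₃.X := by
    rw [← tensorHom_id, ← tensorHom_id, tensorHom_comp_tensorHom, tensorHom_comp_tensorHom,
      quo_tensorHom]
    simp
  have h2 : X₁.X ◁ quo X₂ X₃ ≫ (f₁.hom ⊗ₘ (tensorHom f₂ f₃).hom) =
      (f₁.hom ⊗ₘ (f₂.hom ⊗ₘ f₃.hom)) ≫ Y₁.X ◁ quo Y₂ Y₃ := by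
    rw [← id_tensorHom, ← id_tensorHom, tensorHom_comp_tensorHom, tensorHom_comp_tensorHom,
      quo_tensorHom]
    simp
  rw [reassoc_of% h1, reassoc_of% h2, quo_associator, associator_naturality_assoc]

theorem leftUnitor_natural {X Y : RMod M} (f : X ⟶ Y) :
    tensorHom (𝟙 (unit M)) f ≫ (leftUnitor Y).hom = (leftUnitor X).hom ≫ f := by
  ext
  refine (cancel_epi (quo (unit M) X)).1 ?_
  rw [comp_hom, comp_hom, reassoc_of% quo_tensorHom, quo_leftUnitor, reassoc_of% quo_leftUnitor,
    id_hom, id_tensorHom]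
  exact (lact_natural f).symm

theorem rightUnitor_natural {X Y : RMod M} (f : X ⟶ Y) :
    tensorHom f (𝟙 (unit M)) ≫ (rightUnitor Y).hom = (rightUnitor X).hom ≫ f := by
  ext
  refine (cancel_epi (quo X (unit M))).1 ?_
  rw [comp_hom, comp_hom, reassoc_of% quo_tensorHom, quo_rightUnitor, reassoc_of% quo_rightUnitor,
    id_hom, tensorHom_id]
  exact f.comm.symm

theorem quo_tensorHom_id {X X' : RMod M} (f : X ⟶ X') (Y : RMod M) :
    quo X Y ≫ (tensorHom f (𝟙 Y)).hom = f.hom ▷ Y.X ≫ quo X' Y := by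
  rw [quo_tensorHom, id_hom, tensorHom_id]

theorem quo_id_tensorHom {Y Y' : RMod M} (X : RMod M) (f : Y ⟶ Y') :
    quo X Y ≫ (tensorHom (𝟙 X) f).hom = X.X ◁ f.hom ≫ quo X Y' := by
  rw [quo_tensorHom, id_hom, id_tensorHom]

theorem pentagon_aux (W X Y Z : RMod M) :
    tensorHom (associator W X Y).hom (𝟙 Z) ≫ (associator W (tensorObj X Y) Z).hom ≫
        tensorHom (𝟙 W) (associator X Y Z).hom =
      (associator (tensorObj W X) Y Z).hom ≫ (associator W X (tensorObj Y Z)).hom := by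
  ext
  refine (cancel_epi (quo (tensorObj (tensorObj W X) Y) Z)).1
    ((cancel_epi (quo (tensorObj W X) Y ▷ Z.X)).1 ((cancel_epi (quo W X ▷ Y.X ▷ Z.X)).1 ?_))
  have h1 := congrArg (fun t => t ▷ Z.X) (quo_associator W X Y)
  have h2 := congrArg (fun t => W.X ◁ t) (quo_associator X Y Z)
  simp only [comp_whiskerRight, MonoidalCategory.whiskerLeft_comp] at h1 h2
  simp only [comp_hom]
  rw [reassoc_of% quo_tensorHom_id, reassoc_of% h1, reassoc_of% quo_associator, quo_id_tensorHom,
    associator_naturality_middle_assoc, reassoc_of% h2, reassoc_of% quo_associator,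
    associator_naturality_left_assoc, ← whisker_exchange_assoc, quo_associator]
  monoidal

theorem triangle_aux (X Y : RMod M) :
    (associator X (unit M) Y).hom ≫ tensorHom (𝟙 X) (leftUnitor Y).hom =
      tensorHom (rightUnitor X).hom (𝟙 Y) := by
  ext
  refine (cancel_epi (quo (tensorObj X (unit M)) Y)).1
    ((cancel_epi (quo X (unit M) ▷ Y.X)).1 ?_)
  have h1 := congrArg (fun t => t ▷ Y.X) (quo_rightUnitor X)
  have h2 := congrArg (fun t => X.X ◁ t) (quo_leftUnitor Y)
  simp only [comp_whiskerRight, MonoidalCategory.whiskerLeft_comp] at h1 h2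
  simp only [comp_hom]
  rw [reassoc_of% quo_associator, quo_id_tensorHom, reassoc_of% h2, quo_tensorHom_id, reassoc_of% h1]
  exact (act_quo X Y).symm

noncomputable instance : MonoidalCategory (RMod M) :=
  MonoidalCategory.ofTensorHom
    (id_tensorHom_id := tensorHom_id_id)
    (id_tensorHom := fun _ _ _ _ => rfl)
    (tensorHom_id := fun _ _ => rfl)
    (tensorHom_comp_tensorHom := tensorHom_comp)
    (associator_naturality := assoc_naturality)
    (leftUnitor_naturality := leftUnitor_natural)
    (rightUnitor_naturality := rightUnitor_natural)
    (pentagon := pentagon_aux)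
    (triangle := triangle_aux)

/-- A right module is local if acting after the double braiding with `M` is the same as acting. -/
def isLocal (M : B) [MonObj M] : ObjectProperty (RMod M) := fun X =>
  (β_ X.X M).hom ≫ (β_ M X.X).hom ≫ X.act = X.act

theorem isLocal_iff (X : RMod M) : isLocal M X ↔ (β_ X.X M).hom ≫ X.lact = X.act := Iff.rfl

theorem isLocal_unit : isLocal M (𝟙_ (RMod M)) := by
  change (β_ M M).hom ≫ (β_ M M).hom ≫ μ[M] = μ[M]
  simp

theorem isLocal_tensor (X Y : RMod M) (hX : isLocal M X) (hY : isLocal M Y) :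
    isLocal M (X ⊗ Y) := by
  rw [isLocal_iff] at *
  change (β_ (tensorObj X Y).X M).hom ≫ (tensorObj X Y).lact = (tensorObj X Y).act
  have h1 := congrArg (fun t => t ▷ Y.X) hX
  have h2 := congrArg (fun t => X.X ◁ t) hY
  simp only [comp_whiskerRight, MonoidalCategory.whiskerLeft_comp] at h1 h2
  refine (cancel_epi (quo X Y ▷ M)).1 ?_
  rw [BraidedCategory.braiding_naturality_left_assoc, quo_lact, quo_act,
    BraidedCategory.braiding_tensor_left_hom]
  simp only [Category.assoc, Iso.hom_inv_id_assoc]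
  rw [reassoc_of% h1, act_quo, ← reassoc_of% h2]
  simp

instance : (isLocal M).IsMonoidal where
  prop_unit := isLocal_unit
  prop_tensor _ _ hX hY := isLocal_tensor _ _ hX hY

/-- The braiding with a local module descends to the tensor product over `M`. -/
noncomputable def braidHom (X Y : RMod M) (hX : isLocal M X) : tensorObj X Y ⟶ tensorObj Y X :=
  descHom X Y _ ((β_ X.X Y.X).hom ≫ quo Y X)
    (by
      rw [isLocal_iff] at hX
      have h1 := congrArg (fun t => Y.X ◁ t) hX
      simp only [MonoidalCategory.whiskerLeft_comp] at h1
      rw [BraidedCategory.braiding_naturality_left_assoc]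
      conv_rhs => rw [lact, MonoidalCategory.whiskerLeft_comp_assoc,
        BraidedCategory.braiding_naturality_right_assoc, act_quo]
      rw [← reassoc_of% h1, BraidedCategory.braiding_tensor_right_hom,
        BraidedCategory.braiding_tensor_left_hom]
      simp)
    (by
      rw [isLocal_iff] at hX
      have h1 := congrArg (fun t => Y.X ◁ t) hX
      simp only [MonoidalCategory.whiskerLeft_comp] at h1
      rw [BraidedCategory.braiding_naturality_right_assoc, act_quo, comp_whiskerRight_assoc,
        quo_act, ← h1]
      simp)


theorem quo_braidHom (X Y : RMod M) (hX : isLocal M X) :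
    quo X Y ≫ (braidHom X Y hX).hom = (β_ X.X Y.X).hom ≫ quo Y X :=
  quo_descHom _ _ _ _ _ _

theorem braidInv_w (X Y : RMod M) (hX : isLocal M X) :
    pairL Y X ≫ (β_ X.X Y.X).inv ≫ quo X Y = pairR Y X ≫ (β_ X.X Y.X).inv ≫ quo X Y := by
  rw [isLocal_iff] at hX
  have h1 := congrArg (fun t => Y.X ◁ t) hX
  simp only [MonoidalCategory.whiskerLeft_comp] at h1
  refine (cancel_epi (β_ X.X (Y.X ⊗ M)).hom).1 ?_
  simp only [pairL, pairR, Category.assoc]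
  rw [← BraidedCategory.braiding_naturality_right_assoc, Iso.hom_inv_id_assoc,
    BraidedCategory.braiding_tensor_right_hom]
  simp only [Category.assoc, Iso.inv_hom_id_assoc]
  rw [reassoc_of% h1, BraidedCategory.braiding_inv_naturality_right_assoc, act_quo,
    BraidedCategory.braiding_tensor_left_inv, lact]
  simp

/-- The inverse of the braiding of local modules. -/
noncomputable def braidInv (X Y : RMod M) (hX : isLocal M X) :
    (tensorObj Y X).X ⟶ (tensorObj X Y).X :=
  (isCoeq_quo Y X).desc ((β_ X.X Y.X).inv ≫ quo X Y) (braidInv_w X Y hX)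

theorem quo_braidInv (X Y : RMod M) (hX : isLocal M X) :
    quo Y X ≫ braidInv X Y hX = (β_ X.X Y.X).inv ≫ quo X Y :=
  (isCoeq_quo Y X).fac _ (braidInv_w X Y hX)

/-- The braiding of a local module with a module. -/
noncomputable def braid (X Y : RMod M) (hX : isLocal M X) : tensorObj X Y ≅ tensorObj Y X :=
  isoMk (braidHom X Y hX) (braidInv X Y hX)
    (by
      refine (cancel_epi (quo X Y)).1 ?_
      rw [reassoc_of% quo_braidHom, quo_braidInv]
      simp)
    (by
      refine (cancel_epi (quo Y X)).1 ?_
      rw [reassoc_of% quo_braidInv, quo_braidHom]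
      simp)

theorem braid_naturality_right (X : RMod M) {Y Z : RMod M} (hX : isLocal M X) (f : Y ⟶ Z) :
    tensorHom (𝟙 X) f ≫ braidHom X Z hX = braidHom X Y hX ≫ tensorHom f (𝟙 X) := by
  ext
  refine (cancel_epi (quo X Y)).1 ?_
  rw [comp_hom, comp_hom, reassoc_of% quo_id_tensorHom, quo_braidHom, reassoc_of% quo_braidHom,
    quo_tensorHom_id, BraidedCategory.braiding_naturality_right_assoc]

theorem braid_naturality_left {X Y : RMod M} (hX : isLocal M X) (hY : isLocal M Y) (f : X ⟶ Y)
    (Z : RMod M) :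
    tensorHom f (𝟙 Z) ≫ braidHom Y Z hY = braidHom X Z hX ≫ tensorHom (𝟙 Z) f := by
  ext
  refine (cancel_epi (quo X Z)).1 ?_
  rw [comp_hom, comp_hom, reassoc_of% quo_tensorHom_id, quo_braidHom, reassoc_of% quo_braidHom,
    quo_id_tensorHom, BraidedCategory.braiding_naturality_left_assoc]

theorem braid_hexagon_forward (X Y Z : RMod M) (hX : isLocal M X) :
    (associator X Y Z).hom ≫ braidHom X (tensorObj Y Z) hX ≫ (associator Y Z X).hom =
      tensorHom (braidHom X Y hX) (𝟙 Z) ≫ (associator Y X Z).hom ≫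
        tensorHom (𝟙 Y) (braidHom X Z hX) := by
  ext
  refine (cancel_epi (quo (tensorObj X Y) Z)).1 ((cancel_epi (quo X Y ▷ Z.X)).1 ?_)
  have h1 := congrArg (· ▷ Z.X) (quo_braidHom X Y hX)
  have h2 := congrArg (Y.X ◁ ·) (quo_braidHom X Z hX)
  simp only [comp_whiskerRight, MonoidalCategory.whiskerLeft_comp] at h1 h2
  simp only [comp_hom]
  rw [reassoc_of% quo_associator, reassoc_of% quo_braidHom, BraidedCategory.braiding_naturality_right_assoc,
    quo_associator, reassoc_of% quo_tensorHom_id, reassoc_of% h1, reassoc_of% quo_associator,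
    quo_id_tensorHom, reassoc_of% h2]
  simp

theorem quo_associator_inv (X Y Z : RMod M) :
    X.X ◁ quo Y Z ≫ quo X (tensorObj Y Z) ≫ (associator X Y Z).inv.hom =
      (α_ _ _ _).inv ≫ quo X Y ▷ Z.X ≫ quo (tensorObj X Y) Z :=
  quo_assocInv X Y Z

theorem braid_hexagon_reverse (X Y Z : RMod M) (hX : isLocal M X) (hY : isLocal M Y)
    (hXY : isLocal M (tensorObj X Y)) :
    (associator X Y Z).inv ≫ braidHom (tensorObj X Y) Z hXY ≫ (associator Z X Y).inv =
      tensorHom (𝟙 X) (braidHom Y Z hY) ≫ (associator X Z Y).inv ≫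
        tensorHom (braidHom X Z hX) (𝟙 Y) := by
  ext
  refine (cancel_epi (quo X (tensorObj Y Z))).1 ((cancel_epi (X.X ◁ quo Y Z)).1 ?_)
  have h1 := congrArg (X.X ◁ ·) (quo_braidHom Y Z hY)
  have h2 := congrArg (· ▷ Y.X) (quo_braidHom X Z hX)
  simp only [comp_whiskerRight, MonoidalCategory.whiskerLeft_comp] at h1 h2
  simp only [comp_hom]
  rw [reassoc_of% quo_associator_inv, reassoc_of% quo_braidHom,
    BraidedCategory.braiding_naturality_left_assoc, quo_associator_inv,
    reassoc_of% quo_id_tensorHom, reassoc_of% h1, reassoc_of% quo_associator_inv,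
    quo_tensorHom_id, reassoc_of% h2]
  simp

end RMod

/-- The category of local right modules over a commutative monoid `M` in a braided monoidal
category, as a full subcategory of the category of right modules. -/
abbrev LocMod [BraidedCategory B] (M : B) [MonObj M] := (RMod.isLocal M).FullSubcategory

noncomputable instance [BraidedCategory B] (M : B) [MonObj M] [IsCommMonObj M]
    [ReflexiveMonoidal B] : BraidedCategory (LocMod M) where
  braiding X Y := ObjectProperty.isoMk _ (RMod.braid X.obj Y.obj X.property)
  braiding_naturality_right X _ _ f :=
    ObjectProperty.hom_ext _ (RMod.braid_naturality_right X.obj X.property f.hom)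
  braiding_naturality_left {X Y} f Z :=
    ObjectProperty.hom_ext _ (RMod.braid_naturality_left X.property Y.property f.hom Z.obj)
  hexagon_forward X Y Z :=
    ObjectProperty.hom_ext _ (RMod.braid_hexagon_forward X.obj Y.obj Z.obj X.property)
  hexagon_reverse X Y Z :=
    ObjectProperty.hom_ext _ (RMod.braid_hexagon_reverse X.obj Y.obj Z.obj X.property Y.property
      (X ⊗ Y).property)

end RightModules

section CenterCoequalizers

variable {C : Type u₁} [Category.{v₁} C] [MonoidalCategory C]

instance isReflexivePair_center {X Y : Center C} (f g : X ⟶ Y) [IsReflexivePair f g] :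
    IsReflexivePair f.f g.f :=
  IsReflexivePair.mk' (commonSection f g).f
    (by rw [← Center.comp_f, section_comp_left]; rfl)
    (by rw [← Center.comp_f, section_comp_right]; rfl)

variable [ReflexiveMonoidal C]

/-- Coequalizers of reflexive pairs in the center may be tested on underlying objects. -/
theorem isCoeq_center {X Y Q : Center C} (f g : X ⟶ Y) [IsReflexivePair f g] (q : Y ⟶ Q)
    (h : IsCoeq f.f g.f q.f) : IsCoeq f g q where
  w := by ext; exact h.w
  existsUnique Z k hk := by
    have := h.epi
    have hk' : f.f ≫ k.f = g.f ≫ k.f := by rw [← Center.comp_f, hk, Center.comp_f]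
    refine ⟨⟨h.desc k.f hk', fun U => ?_⟩, ?_, ?_⟩
    · have := (h.whiskerRight U).epi
      refine (cancel_epi (q.f ▷ U)).1 ?_
      rw [← comp_whiskerRight_assoc, h.fac, k.comm, q.comm_assoc,
        ← MonoidalCategory.whiskerLeft_comp, h.fac]
    · ext; exact h.fac _ hk'
    · intro d hd
      ext
      refine (cancel_epi q.f).1 ?_
      rw [← Center.comp_f, hd]
      exact (h.fac _ hk').symm

section

variable {X Y : Center C} (f g : X ⟶ Y) [IsReflexivePair f g]
  {Q : C} {q : Y.1 ⟶ Q} (h : IsCoeq f.f g.f q)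

theorem coeqHalfBraiding_w {X Y : Center C} (f g : X ⟶ Y)
    {Q : C} {q : Y.1 ⟶ Q} (h : IsCoeq f.f g.f q) (U : C) :
    f.f ▷ U ≫ (Y.2.β U).hom ≫ U ◁ q = g.f ▷ U ≫ (Y.2.β U).hom ≫ U ◁ q := by
  rw [f.comm_assoc, g.comm_assoc, ← MonoidalCategory.whiskerLeft_comp,
    ← MonoidalCategory.whiskerLeft_comp, h.w]

/-- The half-braiding on a coequalizer of underlying objects. -/
noncomputable def coeqHalfBraiding : HalfBraiding Q where
  β U :=
    { hom := (h.whiskerRight U).desc ((Y.2.β U).hom ≫ U ◁ q) (coeqHalfBraiding_w f g h U)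
      inv := (h.whiskerLeft U).desc ((Y.2.β U).inv ≫ q ▷ U) (by
        refine (cancel_epi (X.2.β U).hom).1 ?_
        rw [← f.comm_assoc, ← g.comm_assoc, Iso.hom_inv_id_assoc,
          ← comp_whiskerRight, ← comp_whiskerRight, h.w])
      hom_inv_id := by
        have := (h.whiskerRight U).epi
        refine (cancel_epi (q ▷ U)).1 ?_
        rw [reassoc_of% (h.whiskerRight U).fac, Category.assoc, (h.whiskerLeft U).fac]
        simp
      inv_hom_id := by
        have := (h.whiskerLeft U).epi
        refine (cancel_epi (U ◁ q)).1 ?_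
        rw [reassoc_of% (h.whiskerLeft U).fac, Category.assoc, (h.whiskerRight U).fac]
        simp }
  monoidal U U' := by
    have := (h.whiskerRight (U ⊗ U')).epi
    refine (cancel_epi (q ▷ (U ⊗ U'))).1 ?_
    have h1 := congrArg (· ▷ U') ((h.whiskerRight U).fac ((Y.2.β U).hom ≫ U ◁ q) (coeqHalfBraiding_w f g h U))
    have h2 := congrArg (U ◁ ·) ((h.whiskerRight U').fac ((Y.2.β U').hom ≫ U' ◁ q) (coeqHalfBraiding_w f g h U'))
    simp only [comp_whiskerRight, MonoidalCategory.whiskerLeft_comp] at h1 h2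
    rw [(h.whiskerRight (U ⊗ U')).fac, associator_inv_naturality_left_assoc, reassoc_of% h1,
      associator_naturality_middle_assoc, reassoc_of% h2]
    simp
  naturality {U U'} k := by
    have := (h.whiskerRight U).epi
    refine (cancel_epi (q ▷ U)).1 ?_
    rw [← whisker_exchange_assoc, (h.whiskerRight U').fac, reassoc_of% (h.whiskerRight U).fac,
      HalfBraiding.naturality_assoc, Category.assoc, whisker_exchange]

theorem exists_center_coeq {X Y : Center C} (f g : X ⟶ Y) [IsReflexivePair f g]
    {Q : C} {q : Y.1 ⟶ Q} (h : IsCoeq f.f g.f q) : ∃ (Q' : Center C) (q' : Y ⟶ Q'), IsCoeq f.f g.f q'.f :=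
  ⟨⟨Q, coeqHalfBraiding f g h⟩, ⟨q, fun U =>
    (h.whiskerRight U).fac _ (coeqHalfBraiding_w f g h U)⟩, h⟩

end

theorem isCoeq_of_center {X Y Q : Center C} (f g : X ⟶ Y) [IsReflexivePair f g] (q : Y ⟶ Q)
    (h : IsCoeq f g q) : IsCoeq f.f g.f q.f := by
  obtain ⟨Q', q', h'⟩ := exists_center_coeq f g (IsCoeq.of_coequalizer f.f g.f)
  have h'' := isCoeq_center f g q' h'
  have := h.epi
  have := h''.epi
  have e1 := h.fac q' h''.w
  have e2 := h''.fac q h.w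
  have i1 : h.desc q' h''.w ≫ h''.desc q h.w = 𝟙 _ := by
    refine (cancel_epi q).1 ?_
    rw [reassoc_of% h.fac, e2, Category.comp_id]
  have i2 : h''.desc q h.w ≫ h.desc q' h''.w = 𝟙 _ := by
    refine (cancel_epi q').1 ?_
    rw [reassoc_of% h''.fac, e1, Category.comp_id]
  refine ⟨by rw [← Center.comp_f, h.w, Center.comp_f], fun Z k hk => ?_⟩
  obtain ⟨d, hd, hu⟩ := h'.existsUnique k hk
  refine ⟨(h.desc q' h''.w).f ≫ d, ?_, fun y hy => ?_⟩
  · dsimp only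
    rw [← Category.assoc, ← Center.comp_f, e1, hd]
  · rw [← hu ((h''.desc q h.w).f ≫ y) (by
      dsimp only
      rw [← Category.assoc, ← Center.comp_f, e2]; exact hy), ← Category.assoc, ← Center.comp_f,
      i1, Center.id_f, Category.id_comp]

instance reflexiveMonoidal_center : ReflexiveMonoidal (Center C) where
  hasReflexiveCoequalizers := ⟨fun X Y f g _ => by
    obtain ⟨Q', q', h'⟩ := exists_center_coeq f g (IsCoeq.of_coequalizer f.f g.f)
    exact ⟨⟨_, (isCoeq_center f g q' h').isColimit⟩⟩⟩
  preserves_tensorLeft Z := preserves_of_isCoeq _ fun X Y Q f g q _ h =>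
    isCoeq_center (Z ◁ f) (Z ◁ g) (Z ◁ q) ((isCoeq_of_center f g q h).whiskerLeft Z.1)
  preserves_tensorRight Z := preserves_of_isCoeq _ fun X Y Q f g q _ h =>
    isCoeq_center (f ▷ Z) (g ▷ Z) (q ▷ Z) ((isCoeq_of_center f g q h).whiskerRight Z.1)

end CenterCoequalizers

section ProjectionFormula

open Functor.LaxMonoidal

variable {C : Type u₁} [Category.{v₁} C] [MonoidalCategory C]
  {D : Type u₂} [Category.{v₂} D] [MonoidalCategory D]
  {G : C ⥤ D} {R : D ⥤ C} [R.LaxMonoidal]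

/-- The component of the unit of an adjunction. -/
def unitHom (adj : G ⊣ R) (A : C) : A ⟶ R.obj (G.obj A) := adj.unit.app A

/-- The left projection formula morphism `A ⊗ R X ⟶ R (G A ⊗ X)`. -/
def lproj (adj : G ⊣ R) (A : C) (X : D) : A ⊗ R.obj X ⟶ R.obj (G.obj A ⊗ X) :=
  unitHom adj A ▷ R.obj X ≫ μ R (G.obj A) X

/-- The right projection formula morphism `R X ⊗ A ⟶ R (X ⊗ G A)`. -/
def rproj (adj : G ⊣ R) (X : D) (A : C) : R.obj X ⊗ A ⟶ R.obj (X ⊗ G.obj A) :=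
  R.obj X ◁ unitHom adj A ≫ μ R X (G.obj A)

/-- The projection formula holds for the right adjoint. -/
class ProjectionFormula (adj : G ⊣ R) : Prop where
  isIso_lproj : ∀ (A : C) (X : D), IsIso (lproj adj A X)
  isIso_rproj : ∀ (X : D) (A : C), IsIso (rproj adj X A)

attribute [instance] ProjectionFormula.isIso_lproj ProjectionFormula.isIso_rproj

/-- A monoidal adjunction: both functors are lax monoidal, and the unit and the counit are
monoidal transformations. -/
class IsMonoidalAdjunction [G.LaxMonoidal] (adj : G ⊣ R) : Prop where
  unit_isMonoidal : NatTrans.IsMonoidal adj.unit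
  counit_isMonoidal : NatTrans.IsMonoidal adj.counit

attribute [instance] IsMonoidalAdjunction.unit_isMonoidal IsMonoidalAdjunction.counit_isMonoidal

variable (adj : G ⊣ R)

theorem unitHom_natural {A B : C} (f : A ⟶ B) :
    f ≫ unitHom adj B = unitHom adj A ≫ R.map (G.map f) :=
  adj.unit.naturality f

theorem unitHom_counit (X : D) : unitHom adj (R.obj X) ≫ R.map (adj.counit.app X) = 𝟙 _ :=
  adj.right_triangle_components X

theorem lproj_natural_left {A B : C} (f : A ⟶ B) (X : D) :
    f ▷ R.obj X ≫ lproj adj B X = lproj adj A X ≫ R.map (G.map f ▷ X) := by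
  simp only [lproj, Category.assoc, ← μ_natural_left]
  rw [← comp_whiskerRight_assoc, unitHom_natural, comp_whiskerRight_assoc]

theorem lproj_natural_right (A : C) {X Y : D} (f : X ⟶ Y) :
    A ◁ R.map f ≫ lproj adj A Y = lproj adj A X ≫ R.map (G.obj A ◁ f) := by
  simp only [lproj, Category.assoc, ← μ_natural_right]
  rw [whisker_exchange_assoc]

theorem rproj_natural_left {X Y : D} (f : X ⟶ Y) (A : C) :
    R.map f ▷ A ≫ rproj adj Y A = rproj adj X A ≫ R.map (f ▷ G.obj A) := by
  simp only [rproj, Category.assoc, ← μ_natural_left]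
  rw [← whisker_exchange_assoc]

theorem rproj_natural_right (X : D) {A B : C} (f : A ⟶ B) :
    R.obj X ◁ f ≫ rproj adj X B = rproj adj X A ≫ R.map (X ◁ G.map f) := by
  simp only [rproj, Category.assoc, ← μ_natural_right]
  rw [← MonoidalCategory.whiskerLeft_comp_assoc, unitHom_natural,
    MonoidalCategory.whiskerLeft_comp_assoc]

theorem lproj_counit (X Y : D) :
    lproj adj (R.obj Y) X ≫ R.map (adj.counit.app Y ▷ X) = μ R Y X := by
  have h := μ_natural_left R (adj.counit.app Y) X
  rw [lproj, Category.assoc]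
  erw [← h]
  rw [← comp_whiskerRight_assoc, unitHom_counit]
  simp

theorem rproj_counit (X Y : D) :
    rproj adj X (R.obj Y) ≫ R.map (X ◁ adj.counit.app Y) = μ R X Y := by
  have h := μ_natural_right R X (adj.counit.app Y)
  rw [rproj, Category.assoc]
  erw [← h]
  rw [← MonoidalCategory.whiskerLeft_comp_assoc, unitHom_counit]
  simp

theorem lproj_rproj (A : C) (X : D) (B : C) :
    lproj adj A X ▷ B ≫ rproj adj (G.obj A ⊗ X) B ≫ R.map (α_ _ _ _).hom =
      (α_ _ _ _).hom ≫ A ◁ rproj adj X B ≫ lproj adj A (X ⊗ G.obj B) := by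
  simp only [lproj, rproj, comp_whiskerRight, MonoidalCategory.whiskerLeft_comp, Category.assoc]
  rw [← whisker_exchange_assoc, associativity, whisker_exchange_assoc, whisker_exchange_assoc]
  monoidal

/-- Compatibility of the left projection formula with the lax structure. -/
theorem lax_lproj (A : C) (X Y : D) :
    A ◁ μ R X Y ≫ lproj adj A (X ⊗ Y) =
      (α_ _ _ _).inv ≫ lproj adj A X ▷ R.obj Y ≫ μ R (G.obj A ⊗ X) Y ≫ R.map (α_ _ _ _).hom := by
  simp only [lproj, comp_whiskerRight, Category.assoc]
  rw [associativity, whisker_exchange_assoc]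
  monoidal

/-- Compatibility of the right projection formula with the lax structure. -/
theorem lax_rproj (X Y : D) (A : C) :
    μ R X Y ▷ A ≫ rproj adj (X ⊗ Y) A ≫ R.map (α_ _ _ _).hom =
      (α_ _ _ _).hom ≫ R.obj X ◁ rproj adj Y A ≫ μ R X (Y ⊗ G.obj A) := by
  simp only [rproj, MonoidalCategory.whiskerLeft_comp, Category.assoc]
  rw [← whisker_exchange_assoc, associativity]
  monoidal

/-- The two projection formulas are balanced with respect to the lax structure. -/
theorem rproj_lax (X : D) (A : C) (Y : D) :
    rproj adj X A ▷ R.obj Y ≫ μ R (X ⊗ G.obj A) Y ≫ R.map (α_ _ _ _).hom =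
      (α_ _ _ _).hom ≫ R.obj X ◁ lproj adj A Y ≫ μ R X (G.obj A ⊗ Y) := by
  simp only [lproj, rproj, comp_whiskerRight, MonoidalCategory.whiskerLeft_comp, Category.assoc]
  rw [associativity]
  monoidal

section

variable [G.LaxMonoidal] [IsMonoidalAdjunction adj]

theorem unit_tensor (A B : C) : unitHom adj (A ⊗ B) =
    (unitHom adj A ⊗ₘ unitHom adj B) ≫ μ R (G.obj A) (G.obj B) ≫ R.map (μ G A B) := by
  have := NatTrans.IsMonoidal.tensor (τ := adj.unit) A B
  simpa [unitHom] using this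

theorem lproj_tensor (A B : C) (X : D) :
    lproj adj (A ⊗ B) X =
      (α_ _ _ _).hom ≫ A ◁ lproj adj B X ≫ lproj adj A (G.obj B ⊗ X) ≫
        R.map ((α_ _ _ _).inv ≫ μ G A B ▷ X) := by
  have h := associativity R (G.obj A) (G.obj B) X
  have h' : μ R (G.obj A) (G.obj B) ▷ R.obj X ≫ μ R (G.obj A ⊗ G.obj B) X =
      (α_ _ _ _).hom ≫ R.obj (G.obj A) ◁ μ R (G.obj B) X ≫ μ R (G.obj A) (G.obj B ⊗ X) ≫
        R.map (α_ _ _ _).inv := by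
    rw [← reassoc_of% h, ← R.map_comp, Iso.hom_inv_id, R.map_id, Category.comp_id]
  simp only [lproj, unit_tensor, comp_whiskerRight, Category.assoc, μ_natural_left,
    MonoidalCategory.whiskerLeft_comp, R.map_comp]
  rw [reassoc_of% h', whisker_exchange_assoc, MonoidalCategory.tensorHom_def]
  simp only [comp_whiskerRight, Category.assoc, associator_naturality_left_assoc,
    associator_naturality_middle_assoc, whisker_exchange_assoc]

theorem rproj_tensor (X : D) (A B : C) :
    rproj adj X (A ⊗ B) =
      (α_ _ _ _).inv ≫ rproj adj X A ▷ B ≫ rproj adj (X ⊗ G.obj A) B ≫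
        R.map ((α_ _ _ _).hom ≫ X ◁ μ G A B) := by
  have h := associativity R X (G.obj A) (G.obj B)
  simp only [rproj, unit_tensor, comp_whiskerRight, Category.assoc, μ_natural_right,
    MonoidalCategory.whiskerLeft_comp, R.map_comp]
  rw [← whisker_exchange_assoc, reassoc_of% h, MonoidalCategory.tensorHom_def]
  monoidal

end

section

variable [ProjectionFormula adj]

/-- The half-braiding on `R X` induced by a half-braiding on `X`. -/
noncomputable def inducedIso {X : D} (c : HalfBraiding X) (A : C) :
    R.obj X ⊗ A ≅ A ⊗ R.obj X :=
  asIso (rproj adj X A) ≪≫ R.mapIso (c.β (G.obj A)) ≪≫ (asIso (lproj adj A X)).symm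

theorem inducedIso_lproj {X : D} (c : HalfBraiding X) (A : C) :
    (inducedIso adj c A).hom ≫ lproj adj A X = rproj adj X A ≫ R.map (c.β (G.obj A)).hom := by
  simp [inducedIso]

/-- The half-braiding on `R X` induced by a half-braiding on `X`. -/
noncomputable def inducedHalfBraiding [G.LaxMonoidal] [IsMonoidalAdjunction adj] {X : D}
    (c : HalfBraiding X) : HalfBraiding (R.obj X) where
  β := inducedIso adj c
  naturality {A B} f := by
    rw [← cancel_mono (lproj adj B X), Category.assoc, Category.assoc, inducedIso_lproj,
      lproj_natural_left, reassoc_of% inducedIso_lproj, reassoc_of% rproj_natural_right,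
      ← R.map_comp, ← R.map_comp, HalfBraiding.naturality]
  monoidal A B := by
    have h1 := congrArg (A ◁ ·) (inducedIso_lproj adj c B)
    have h2 := congrArg (· ▷ B) (inducedIso_lproj adj c A)
    simp only [comp_whiskerRight, MonoidalCategory.whiskerLeft_comp] at h1 h2
    rw [← cancel_mono (lproj adj (A ⊗ B) X), inducedIso_lproj, lproj_tensor, rproj_tensor]
    simp only [Category.assoc, Iso.inv_hom_id_assoc]
    rw [reassoc_of% h1, reassoc_of% lproj_natural_right, ← reassoc_of% lproj_rproj, reassoc_of% h2,
      reassoc_of% rproj_natural_left]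
    simp only [← R.map_comp, Category.assoc]
    rw [HalfBraiding.naturality, HalfBraiding.monoidal]
    simp

theorem induced_natural {X Y : D} (c : HalfBraiding X) (d : HalfBraiding Y) (f : X ⟶ Y)
    (hf : ∀ U, f ▷ U ≫ (d.β U).hom = (c.β U).hom ≫ U ◁ f) (A : C) :
    R.map f ▷ A ≫ (inducedIso adj d A).hom = (inducedIso adj c A).hom ≫ A ◁ R.map f := by
  rw [← cancel_mono (lproj adj A Y), Category.assoc, Category.assoc, inducedIso_lproj,
    lproj_natural_right, reassoc_of% inducedIso_lproj, reassoc_of% rproj_natural_left,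
    ← R.map_comp, ← R.map_comp, hf]

theorem induced_ε (c : HalfBraiding (𝟙_ D)) (hc : ∀ U, (c.β U).hom = (λ_ U).hom ≫ (ρ_ U).inv)
    (A : C) :
    ε R ▷ A ≫ (inducedIso adj c A).hom = ((λ_ A).hom ≫ (ρ_ A).inv) ≫ A ◁ ε R := by
  have h := left_unitality R (G.obj A)
  have h' : R.map (ρ_ (G.obj A)).inv = (ρ_ _).inv ≫ R.obj (G.obj A) ◁ ε R ≫ μ R _ _ := by
    simp
  rw [← cancel_mono (lproj adj A (𝟙_ D)), Category.assoc, inducedIso_lproj, hc]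
  simp only [rproj, lproj, Category.assoc, R.map_comp]
  rw [← whisker_exchange_assoc, ← reassoc_of% h, h', whisker_exchange_assoc]
  simp

theorem induced_μ {X Y : D} (c : HalfBraiding X) (d : HalfBraiding Y) (e : HalfBraiding (X ⊗ Y))
    (he : ∀ U, (e.β U).hom = (α_ _ _ _).hom ≫ X ◁ (d.β U).hom ≫ (α_ _ _ _).inv ≫
      (c.β U).hom ▷ Y ≫ (α_ _ _ _).hom) (A : C) :
    μ R X Y ▷ A ≫ (inducedIso adj e A).hom =
      ((α_ _ _ _).hom ≫ R.obj X ◁ (inducedIso adj d A).hom ≫ (α_ _ _ _).inv ≫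
        (inducedIso adj c A).hom ▷ R.obj Y ≫ (α_ _ _ _).hom) ≫ A ◁ μ R X Y := by
  have h1 := congrArg (R.obj X ◁ ·) (inducedIso_lproj adj d A)
  have h2 := congrArg (· ▷ R.obj Y) (inducedIso_lproj adj c A)
  simp only [comp_whiskerRight, MonoidalCategory.whiskerLeft_comp] at h1 h2
  have h3 : rproj adj X A ▷ R.obj Y ≫ μ R (X ⊗ G.obj A) Y =
      (α_ _ _ _).hom ≫ R.obj X ◁ lproj adj A Y ≫ μ R X (G.obj A ⊗ Y) ≫ R.map (α_ _ _ _).inv := by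
    rw [← reassoc_of% rproj_lax adj X A Y, ← R.map_comp, Iso.hom_inv_id, R.map_id,
      Category.comp_id]
  have h4 := lax_rproj adj X Y A
  rw [← cancel_mono (lproj adj A (X ⊗ Y)), Category.assoc, inducedIso_lproj, he]
  simp only [Category.assoc, R.map_comp]
  rw [lax_lproj, reassoc_of% h4, Iso.hom_inv_id_assoc, reassoc_of% h2, μ_natural_left_assoc,
    reassoc_of% h3, Iso.inv_hom_id_assoc, reassoc_of% h1, μ_natural_right_assoc]

theorem induced_braided {X : D} (c : HalfBraiding X) (Y : D) :
    μ R X Y ≫ R.map (c.β Y).hom = (inducedIso adj c (R.obj Y)).hom ≫ μ R Y X := by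
  have h := c.naturality (adj.counit.app Y)
  rw [← lproj_counit adj X Y, reassoc_of% inducedIso_lproj, ← R.map_comp]
  erw [← h]
  rw [R.map_comp, reassoc_of% rproj_counit adj X Y]
  rfl

end

section

variable [ProjectionFormula adj] [G.LaxMonoidal] [IsMonoidalAdjunction adj]

/-- The functor on Drinfeld centers induced by the right adjoint of a monoidal adjunction
satisfying the projection formula. -/
noncomputable def centerMap : Center D ⥤ Center C where
  obj X := ⟨R.obj X.1, inducedHalfBraiding adj X.2⟩
  map {X Y} f := ⟨R.map f.f, induced_natural adj X.2 Y.2 f.f f.comm⟩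
  map_id X := by ext; exact R.map_id _
  map_comp f g := by ext; exact R.map_comp _ _

/-- The induced functor on centers is lax monoidal, with the structure morphisms of `R`. -/
noncomputable instance : (centerMap adj).LaxMonoidal where
  ε := ⟨ε R, induced_ε adj _ fun _ => rfl⟩
  μ X Y := ⟨μ R X.1 Y.1, induced_μ adj X.2 Y.2 _ fun _ => rfl⟩
  μ_natural_left f Z := by ext; exact μ_natural_left R f.f Z.1
  μ_natural_right Z f := by ext; exact μ_natural_right R Z.1 f.f
  associativity X Y Z := by ext; exact associativity R X.1 Y.1 Z.1
  left_unitality X := by ext; exact left_unitality R X.1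
  right_unitality X := by ext; exact right_unitality R X.1

noncomputable instance : (centerMap adj).LaxBraided where
  braided X Y := by ext; exact induced_braided adj X.2 Y.1

/-- The commutative monoid `R(𝟙)` in the center of `C`. -/
noncomputable def centralMonoid : CommMon (Center C) :=
  (centerMap adj).mapCommMon.obj (CommMon.trivial (Center D))

end

end ProjectionFormula

end MonoidalMonadicity

/-! The proof combines monadicity of `R` with the projection formula, and then carries
half-braidings along. Write M = R(𝟙). Since A ⊗ M ≅ R(G A) by `lproj` at 𝟙, compatibly with units
and multiplications, an algebra for the monad RG is the same as a right M-module. As `R` preserves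
reflexive coequalizers and reflects isomorphisms, the crude monadicity argument applies: every
M-module in C is isomorphic to some R X (`exists_iso_of_module`), `R` is faithful, and every
M-linear map R X ⟶ R Y is R of a map (`exists_map_eq_of_linear`).

The lax structure R X ⊗ R U ⟶ R (X ⊗ U) is the quotient onto the relative tensor product over M
(`isCoeq_μ`). Indeed U is the coequalizer of G R G R U ⇉ G R U. Tensoring with X and applying `R`
preserves this, and the projection formula rewrites R (X ⊗ G A) as R X ⊗ A, which turns the pair
into R X ⊗ M ⊗ R U ⇉ R X ⊗ R U.

On centers, a braided lax monoidal functor H always factors through local modules over H(𝟙), because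
the braiding with H(𝟙) only exchanges the left and right unit actions. For H = Z(R) the resulting
functor is strong monoidal by `isCoeq_μ`, since coequalizers of reflexive pairs in the center can be
tested on underlying objects. It is fully faithful because `R` is fully faithful onto M-modules and
compatibility with half-braidings can be checked after `R` and the epimorphisms μ.

Essential surjectivity is where locality enters. The underlying module of a local module is some R
X, with a half-braiding b. Centrality of the action and locality make b at R U exchange the two
parallel maps defining R X ⊗_M R U with those defining R U ⊗_M R X. Hence b descends to an M-linear
isomorphism R (X ⊗ U) ≅ R (U ⊗ X), that is, to an isomorphism X ⊗ U ≅ U ⊗ X. These form a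
half-braiding on X (`exists_halfBraiding`), and the half-braiding it induces on R X is b again
(`inducedIso_eq`). -/

namespace MonoidalMonadicity

open Functor.LaxMonoidal

/-! ### Actions of R(𝟙) on R X coming from the lax structure. -/

section LaxActions

variable {C : Type u₁} [Category.{v₁} C] [MonoidalCategory C]
  {D : Type u₂} [Category.{v₂} D] [MonoidalCategory D] (R : D ⥤ C) [R.LaxMonoidal]

/-- The right action of `R(𝟙)` on `R X` for a lax monoidal functor `R`. -/
def laxActR (X : D) : R.obj X ⊗ R.obj (𝟙_ D) ⟶ R.obj X := μ R X (𝟙_ D) ≫ R.map (ρ_ X).hom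

/-- The left action of `R(𝟙)` on `R X` for a lax monoidal functor `R`. -/
def laxActL (X : D) : R.obj (𝟙_ D) ⊗ R.obj X ⟶ R.obj X := μ R (𝟙_ D) X ≫ R.map (λ_ X).hom

theorem laxActR_natural {X Y : D} (f : X ⟶ Y) :
    laxActR R X ≫ R.map f = R.map f ▷ R.obj (𝟙_ D) ≫ laxActR R Y := by
  simp only [laxActR, Category.assoc, μ_natural_left_assoc, ← R.map_comp, rightUnitor_naturality]

theorem one_laxActR (X : D) : R.obj X ◁ ε R ≫ laxActR R X = (ρ_ (R.obj X)).hom :=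
  (right_unitality R X).symm

theorem one_laxActL (X : D) : ε R ▷ R.obj X ≫ laxActL R X = (λ_ (R.obj X)).hom :=
  (left_unitality R X).symm

theorem μ_laxActR (X Y : D) :
    μ R X Y ▷ R.obj (𝟙_ D) ≫ laxActR R (X ⊗ Y) =
      (α_ _ _ _).hom ≫ R.obj X ◁ laxActR R Y ≫ μ R X Y := by
  have h := associativity R X Y (𝟙_ D)
  simp only [laxActR, MonoidalCategory.whiskerLeft_comp, Category.assoc, μ_natural_right]
  rw [← reassoc_of% h, ← R.map_comp, rightUnitor_tensor_hom]

/-- By the triangle identity, the lax structure is balanced over R(𝟙). This is half of its being a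
relative tensor product; universality is `isCoeq_μ`. -/
theorem laxActR_μ (X Y : D) :
    laxActR R X ▷ R.obj Y ≫ μ R X Y =
      (α_ _ _ _).hom ≫ R.obj X ◁ laxActL R Y ≫ μ R X Y := by
  have h := associativity R X (𝟙_ D) Y
  simp only [laxActL, laxActR, comp_whiskerRight, MonoidalCategory.whiskerLeft_comp,
    Category.assoc, μ_natural_left, μ_natural_right]
  rw [← reassoc_of% h, ← R.map_comp, triangle]

theorem laxActR_laxActR (X : D) :
    laxActR R X ▷ R.obj (𝟙_ D) ≫ laxActR R X =
      (α_ _ _ _).hom ≫ R.obj X ◁ laxActR R (𝟙_ D) ≫ laxActR R X := by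
  -- Associativity of the action is linearity of the lax structure at Y = 𝟙, followed by naturality
  -- of the action along the right unitor.
  have h := μ_laxActR R X (𝟙_ D)
  simp only [laxActR, comp_whiskerRight, Category.assoc] at h ⊢
  rw [← reassoc_of% h]
  have h' := laxActR_natural R (ρ_ X).hom
  simp only [laxActR, Category.assoc] at h'
  rw [h']

theorem μ_associator_inv (X Y Z : D) :
    R.obj X ◁ μ R Y Z ≫ μ R X (Y ⊗ Z) ≫ R.map (α_ X Y Z).inv =
      (α_ _ _ _).inv ≫ μ R X Y ▷ R.obj Z ≫ μ R (X ⊗ Y) Z := by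
  simp

end LaxActions

/-! ### Local modules from a braided lax monoidal functor. -/

section FreeModules

variable {A : Type u₁} [Category.{v₁} A] [MonoidalCategory A] [BraidedCategory A]
  {B : Type u₂} [Category.{v₂} B] [MonoidalCategory B] [BraidedCategory B]
  (H : A ⥤ B) [H.LaxBraided]

/-- The commutative monoid `H(𝟙)` for a braided lax monoidal functor `H`. -/
abbrev unitMon : CommMon B := H.mapCommMon.obj (CommMon.trivial A)

theorem unitMon_one : MonObj.one (X := (unitMon H).X) = ε H := by
  change ε H ≫ H.map (𝟙 _) = _
  simp

/-- The multiplication is built with the left unitor of 𝟙 and the action with the right one; the two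
coincide. -/
theorem unitMon_mul : MonObj.mul (X := (unitMon H).X) = laxActR H (𝟙_ A) := by
  change μ H _ _ ≫ H.map (λ_ _).hom = μ H _ _ ≫ H.map (ρ_ _).hom
  rw [unitors_equal]

/-- The right module over `H(𝟙)` with underlying object `H X`. -/
def toRMod : A ⥤ RMod (unitMon H).X where
  obj X :=
    { X := H.obj X
      act := laxActR H X
      act_one := by rw [unitMon_one]; exact one_laxActR H X
      act_act := by rw [unitMon_mul]; exact laxActR_laxActR H X }
  map f := ⟨H.map f, laxActR_natural H f⟩
  map_id X := by ext; exact H.map_id X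
  map_comp f g := by ext; exact H.map_comp f g

variable [ReflexiveMonoidal B]

/-- Since H is braided, the braiding of H(𝟙) with H X passes through μ to the braiding of 𝟙 with X,
which only exchanges the unitors. The same remark with the factors exchanged gives locality. -/
theorem toRMod_lact (X : A) : ((toRMod H).obj X).lact = laxActL H X := by
  change (β_ (H.obj (𝟙_ A)) (H.obj X)).hom ≫ μ H X (𝟙_ A) ≫ H.map (ρ_ X).hom =
    μ H (𝟙_ A) X ≫ H.map (λ_ X).hom
  rw [← Functor.LaxBraided.braided_assoc, ← H.map_comp, braiding_rightUnitor]

theorem isLocal_toRMod (X : A) : RMod.isLocal (unitMon H).X ((toRMod H).obj X) := by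
  rw [RMod.isLocal_iff, toRMod_lact]
  change (β_ (H.obj X) (H.obj (𝟙_ A))).hom ≫ μ H (𝟙_ A) X ≫ H.map (λ_ X).hom =
    μ H X (𝟙_ A) ≫ H.map (ρ_ X).hom
  rw [← Functor.LaxBraided.braided_assoc, ← H.map_comp, braiding_leftUnitor]

/-- The lax structure of `H` as a morphism between underlying objects of modules. -/
def relμ (X Y : A) :
    ((toRMod H).obj X).X ⊗ ((toRMod H).obj Y).X ⟶ ((toRMod H).obj (X ⊗ Y)).X := μ H X Y

theorem toRMod_balanced (X Y : A) :
    ((toRMod H).obj X).act ▷ ((toRMod H).obj Y).X ≫ relμ H X Y =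
      (α_ ((toRMod H).obj X).X (unitMon H).X ((toRMod H).obj Y).X).hom ≫
        ((toRMod H).obj X).X ◁ ((toRMod H).obj Y).lact ≫ relμ H X Y := by
  rw [toRMod_lact]
  exact laxActR_μ H X Y

/-- The comparison morphism from the relative tensor product. -/
noncomputable def tensorComparison (X Y : A) :
    RMod.tensorObj ((toRMod H).obj X) ((toRMod H).obj Y) ⟶ (toRMod H).obj (X ⊗ Y) :=
  RMod.descHom _ _ ((toRMod H).obj (X ⊗ Y)) (relμ H X Y) (toRMod_balanced H X Y)
    (μ_laxActR H X Y).symm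

theorem quo_tensorComparison (X Y : A) :
    RMod.quo ((toRMod H).obj X) ((toRMod H).obj Y) ≫ (tensorComparison H X Y).hom =
      relμ H X Y :=
  RMod.quo_descHom _ _ ((toRMod H).obj (X ⊗ Y)) _ (toRMod_balanced H X Y) _

/-- This law and the coherence laws that follow reduce, after cancelling the quotient epimorphisms,
to the corresponding properties of the lax structure of H. -/
theorem tensorComparison_natural_left {X Y : A} (f : X ⟶ Y) (Z : A) :
    RMod.tensorHom ((toRMod H).map f) (𝟙 ((toRMod H).obj Z)) ≫ tensorComparison H Y Z =
      tensorComparison H X Z ≫ (toRMod H).map (f ▷ Z) := by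
  ext
  refine (cancel_epi (RMod.quo _ _)).1 ?_
  rw [RMod.comp_hom, RMod.comp_hom, reassoc_of% RMod.quo_tensorHom_id, quo_tensorComparison,
    reassoc_of% quo_tensorComparison]
  exact μ_natural_left H f Z

theorem tensorComparison_natural_right (Z : A) {X Y : A} (f : X ⟶ Y) :
    RMod.tensorHom (𝟙 ((toRMod H).obj Z)) ((toRMod H).map f) ≫ tensorComparison H Z Y =
      tensorComparison H Z X ≫ (toRMod H).map (Z ◁ f) := by
  ext
  refine (cancel_epi (RMod.quo _ _)).1 ?_
  rw [RMod.comp_hom, RMod.comp_hom, reassoc_of% RMod.quo_id_tensorHom, quo_tensorComparison,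
    reassoc_of% quo_tensorComparison]
  exact μ_natural_right H Z f

theorem tensorComparison_associativity (X Y Z : A) :
    RMod.tensorHom (tensorComparison H X Y) (𝟙 ((toRMod H).obj Z)) ≫
        tensorComparison H (X ⊗ Y) Z ≫ (toRMod H).map (α_ X Y Z).hom =
      (RMod.associator _ _ _).hom ≫
        RMod.tensorHom (𝟙 ((toRMod H).obj X)) (tensorComparison H Y Z) ≫
          tensorComparison H X (Y ⊗ Z) := by
  ext
  refine (cancel_epi (RMod.quo _ _)).1 ((cancel_epi (RMod.quo ((toRMod H).obj X)
    ((toRMod H).obj Y) ▷ ((toRMod H).obj Z).X)).1 ?_)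
  have h1 := congrArg (· ▷ ((toRMod H).obj Z).X) (quo_tensorComparison H X Y)
  have h2 := congrArg (((toRMod H).obj X).X ◁ ·) (quo_tensorComparison H Y Z)
  simp only [comp_whiskerRight, MonoidalCategory.whiskerLeft_comp] at h1 h2
  simp only [RMod.comp_hom]
  rw [reassoc_of% RMod.quo_tensorHom_id, reassoc_of% quo_tensorComparison,
    reassoc_of% RMod.quo_associator, reassoc_of% h1, reassoc_of% RMod.quo_id_tensorHom,
    reassoc_of% h2, quo_tensorComparison]
  exact associativity H X Y Z

/-- The unit module is the module of the unit object. -/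
def unitComparison : RMod.unit (unitMon H).X ≅ (toRMod H).obj (𝟙_ A) :=
  RMod.isoMk
    (X := RMod.unit (unitMon H).X) (Y := (toRMod H).obj (𝟙_ A))
    ⟨𝟙 (H.obj (𝟙_ A)), by
      have h : laxActR H (𝟙_ A) ≫ 𝟙 _ = 𝟙 (H.obj (𝟙_ A)) ▷ H.obj (𝟙_ A) ≫ laxActR H (𝟙_ A) := by
        simp
      exact (congrArg (· ≫ 𝟙 (H.obj (𝟙_ A))) (unitMon_mul H)).trans h⟩
    (𝟙 (H.obj (𝟙_ A))) (Category.comp_id _) (Category.comp_id _)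

theorem tensorComparison_left_unitality (X : A) :
    (RMod.leftUnitor ((toRMod H).obj X)).hom =
      RMod.tensorHom (unitComparison H).hom (𝟙 ((toRMod H).obj X)) ≫
        tensorComparison H (𝟙_ A) X ≫ (toRMod H).map (λ_ X).hom := by
  ext
  refine (cancel_epi (RMod.quo _ _)).1 ?_
  simp only [RMod.comp_hom]
  rw [RMod.quo_leftUnitor, reassoc_of% RMod.quo_tensorHom_id, reassoc_of% quo_tensorComparison,
    toRMod_lact]
  have h : laxActL H X = 𝟙 (H.obj (𝟙_ A)) ▷ H.obj X ≫ laxActL H X := by simp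
  exact h

theorem tensorComparison_right_unitality (X : A) :
    (RMod.rightUnitor ((toRMod H).obj X)).hom =
      RMod.tensorHom (𝟙 ((toRMod H).obj X)) (unitComparison H).hom ≫
        tensorComparison H X (𝟙_ A) ≫ (toRMod H).map (ρ_ X).hom := by
  ext
  refine (cancel_epi (RMod.quo _ _)).1 ?_
  simp only [RMod.comp_hom]
  rw [RMod.quo_rightUnitor, reassoc_of% RMod.quo_id_tensorHom, reassoc_of% quo_tensorComparison]
  have h : laxActR H X = H.obj X ◁ 𝟙 (H.obj (𝟙_ A)) ≫ laxActR H X := by simp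
  exact h

theorem tensorComparison_braided (X Y : A) :
    tensorComparison H X Y ≫ (toRMod H).map (β_ X Y).hom =
      RMod.braidHom ((toRMod H).obj X) ((toRMod H).obj Y) (isLocal_toRMod H X) ≫
        tensorComparison H Y X := by
  ext
  refine (cancel_epi (RMod.quo _ _)).1 ?_
  simp only [RMod.comp_hom]
  rw [reassoc_of% quo_tensorComparison, reassoc_of% RMod.quo_braidHom, quo_tensorComparison]
  exact Functor.LaxBraided.braided X Y

theorem isIso_tensorComparison (X Y : A)
    (h : IsCoeq (RMod.pairL ((toRMod H).obj X) ((toRMod H).obj Y))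
      (RMod.pairR ((toRMod H).obj X) ((toRMod H).obj Y)) (relμ H X Y)) :
    IsIso (tensorComparison H X Y) := by
  have hq := RMod.isCoeq_quo ((toRMod H).obj X) ((toRMod H).obj Y)
  have := h.epi
  -- Both morphisms are coequalizers of the same pair, so the comparison is invertible on underlying
  -- objects; linearity of the inverse is then automatic.
  refine (RMod.isoMk (tensorComparison H X Y) (h.desc _ hq.w) ?_ ?_).isIso_hom
  · refine (cancel_epi (RMod.quo _ _)).1 ?_
    rw [reassoc_of% quo_tensorComparison, h.fac]
    exact (Category.comp_id _).symm
  · refine (cancel_epi (relμ H X Y)).1 ?_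
    rw [reassoc_of% h.fac, quo_tensorComparison]
    exact (Category.comp_id _).symm

/-- The functor to local modules over `H(𝟙)` given by a braided lax monoidal functor `H`. -/
def toLocMod : A ⥤ LocMod (unitMon H).X :=
  (RMod.isLocal (unitMon H).X).lift (toRMod H) (isLocal_toRMod H)

/-- The functor to local modules is braided lax monoidal. -/
noncomputable instance laxBraidedToLocMod : (toLocMod H).LaxBraided where
  ε := ObjectProperty.homMk (unitComparison H).hom
  μ X Y := ObjectProperty.homMk (tensorComparison H X Y)
  μ_natural_left f Z := ObjectProperty.hom_ext _ (tensorComparison_natural_left H f Z)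
  μ_natural_right Z f := ObjectProperty.hom_ext _ (tensorComparison_natural_right H Z f)
  associativity X Y Z := ObjectProperty.hom_ext _ (tensorComparison_associativity H X Y Z)
  left_unitality X := ObjectProperty.hom_ext _ (tensorComparison_left_unitality H X)
  right_unitality X := ObjectProperty.hom_ext _ (tensorComparison_right_unitality H X)
  braided X Y := ObjectProperty.hom_ext _ (tensorComparison_braided H X Y)

/-- The functor to local modules is braided monoidal if the lax structure of `H` exhibits the
relative tensor products. -/
theorem nonempty_braided_toLocMod
    (h : ∀ X Y, IsCoeq (RMod.pairL ((toRMod H).obj X) ((toRMod H).obj Y))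
      (RMod.pairR ((toRMod H).obj X) ((toRMod H).obj Y)) (relμ H X Y)) :
    Nonempty (toLocMod H).Braided :=
  have : IsIso (ε (toLocMod H)) :=
    ((RMod.isLocal (unitMon H).X).isoMk (X := 𝟙_ (LocMod (unitMon H).X))
      (Y := (toLocMod H).obj (𝟙_ A)) (unitComparison H)).isIso_hom
  have (X Y : A) : IsIso (μ (toLocMod H) X Y) := by
    have := isIso_tensorComparison H X Y (h X Y)
    let e := asIso (tensorComparison H X Y)
    exact ((RMod.isLocal (unitMon H).X).isoMk (X := (toLocMod H).obj X ⊗ (toLocMod H).obj Y)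
      (Y := (toLocMod H).obj (X ⊗ Y)) e).isIso_hom
  ⟨{ Functor.Monoidal.ofLaxMonoidal (toLocMod H) with
      braided := (laxBraidedToLocMod H).braided }⟩

end FreeModules

/-! ### Crude monadicity of the right adjoint. -/

section Monadicity

variable {C : Type u₁} [Category.{v₁} C] {D : Type u₂} [Category.{v₂} D]
  {G : C ⥤ D} {R : D ⥤ C} (adj : G ⊣ R)

/-- The component of the counit of an adjunction. -/
def counitHom (U : D) : G.obj (R.obj U) ⟶ U := adj.counit.app U

theorem counitHom_natural {U V : D} (f : U ⟶ V) :
    G.map (R.map f) ≫ counitHom adj V = counitHom adj U ≫ f :=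
  adj.counit.naturality f

theorem unitHom_counitHom (U : D) :
    unitHom adj (R.obj U) ≫ R.map (counitHom adj U) = 𝟙 (R.obj U) :=
  adj.right_triangle_components U

theorem unitHom_naturality {A B : C} (f : A ⟶ B) :
    f ≫ unitHom adj B = unitHom adj A ≫ R.map (G.map f) :=
  adj.unit.naturality f

theorem map_unitHom_counitHom (A : C) :
    G.map (unitHom adj A) ≫ counitHom adj (G.obj A) = 𝟙 (G.obj A) :=
  adj.left_triangle_components A

/-- This is a split coequalizer: the units at A and at R G A provide the splitting. -/
theorem isCoeq_of_algebra {A : C} {a : R.obj (G.obj A) ⟶ A} (h₁ : unitHom adj A ≫ a = 𝟙 A)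
    (h₂ : R.map (counitHom adj (G.obj A)) ≫ a = R.map (G.map a) ≫ a) :
    IsCoeq (R.map (G.map a)) (R.map (counitHom adj (G.obj A))) a where
  w := h₂.symm
  existsUnique Z h hh := by
    refine ⟨unitHom adj A ≫ h, ?_, fun d hd => ?_⟩
    · have h₃ := congrArg (unitHom adj (R.obj (G.obj A)) ≫ ·) hh
      dsimp only at h₃ ⊢
      rwa [← reassoc_of% unitHom_naturality, reassoc_of% unitHom_counitHom] at h₃
    · rw [← hd, reassoc_of% h₁]

theorem isReflexivePair_algebra {A : C} {a : R.obj (G.obj A) ⟶ A}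
    (h₁ : unitHom adj A ≫ a = 𝟙 A) : IsReflexivePair (G.map a) (counitHom adj (G.obj A)) :=
  IsReflexivePair.mk' (G.map (unitHom adj A)) (by rw [← G.map_comp, h₁, G.map_id])
    (map_unitHom_counitHom adj A)

instance isReflexivePair_counit (U : D) :
    IsReflexivePair (G.map (R.map (counitHom adj U))) (counitHom adj (G.obj (R.obj U))) :=
  isReflexivePair_algebra adj (unitHom_counitHom adj U)

theorem map_counitHom_comp (U : D) :
    R.map (counitHom adj (G.obj (R.obj U))) ≫ R.map (counitHom adj U) =
      R.map (G.map (R.map (counitHom adj U))) ≫ R.map (counitHom adj U) := by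
  rw [← R.map_comp, ← R.map_comp, counitHom_natural]

variable [HasReflexiveCoequalizers D] [PreservesReflexiveCoequalizers R]

/-- Take X to be the coequalizer in D. Its image under `R` and the algebra A are coequalizers of the
same pair. -/
theorem exists_iso_of_algebra {A : C} {a : R.obj (G.obj A) ⟶ A} (h₁ : unitHom adj A ≫ a = 𝟙 A)
    (h₂ : R.map (counitHom adj (G.obj A)) ≫ a = R.map (G.map a) ≫ a) :
    ∃ (X : D) (p : G.obj A ⟶ X) (i : R.obj X ≅ A),
      IsCoeq (G.map a) (counitHom adj (G.obj A)) p ∧ R.map p ≫ i.hom = a := by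
  have := isReflexivePair_algebra adj h₁
  have ha := isCoeq_of_algebra adj h₁ h₂
  have hp := IsCoeq.of_coequalizer (G.map a) (counitHom adj (G.obj A))
  have hq := hp.map R
  have := ha.epi
  have := hq.epi
  refine ⟨_, _, ⟨hq.desc a ha.w, ha.desc _ hq.w, ?_, ?_⟩, hp, hq.fac a ha.w⟩
  · rw [← cancel_epi (R.map (coequalizer.π _ _)), reassoc_of% hq.fac, ha.fac, Category.comp_id]
  · rw [← cancel_epi a, reassoc_of% ha.fac, hq.fac, Category.comp_id]

theorem algebra_iso_linear {A : C} {a : R.obj (G.obj A) ⟶ A} (h₁ : unitHom adj A ≫ a = 𝟙 A)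
    (h₂ : R.map (counitHom adj (G.obj A)) ≫ a = R.map (G.map a) ≫ a) {X : D} (p : G.obj A ⟶ X)
    (i : R.obj X ≅ A) (hi : R.map p ≫ i.hom = a) :
    R.map (counitHom adj X) ≫ i.hom = R.map (G.map i.hom) ≫ a := by
  have hs : (unitHom adj A ≫ R.map p) ≫ i.hom = 𝟙 A := by rw [Category.assoc, hi, h₁]
  have hs' : i.hom ≫ unitHom adj A ≫ R.map p = 𝟙 _ := by
    rw [← cancel_mono i.hom, Category.assoc, hs, Category.comp_id, Category.id_comp]
  have h : R.map (G.map (R.map p)) ≫ R.map (counitHom adj X) ≫ i.hom =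
      R.map (G.map (R.map p)) ≫ R.map (G.map i.hom) ≫ a := by
    rw [← R.map_comp_assoc, counitHom_natural, R.map_comp_assoc, hi, h₂, ← R.map_comp_assoc,
      ← G.map_comp, hi]
  -- The unit followed by R p inverts i, so R G R p is a split epimorphism and can be cancelled from
  -- the preceding identity.
  have hG : G.map (i.hom ≫ unitHom adj A) ≫ G.map (R.map p) = 𝟙 _ := by
    rw [← G.map_comp, Category.assoc, hs', G.map_id]
  rw [← Category.id_comp (R.map (counitHom adj X) ≫ i.hom), ← R.map_id, ← hG, R.map_comp_assoc, h,
    ← R.map_comp_assoc, hG, R.map_id, Category.id_comp]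

variable [R.ReflectsIsomorphisms]

/-- The comparison k from the actual coequalizer to U becomes the isomorphism of
`exists_iso_of_algebra` under `R`. As `R` reflects isomorphisms, k is invertible. -/
theorem isCoeq_counit (U : D) :
    IsCoeq (G.map (R.map (counitHom adj U))) (counitHom adj (G.obj (R.obj U)))
      (counitHom adj U) := by
  obtain ⟨X, p, i, hp, hi⟩ := exists_iso_of_algebra adj (unitHom_counitHom adj U)
    (map_counitHom_comp adj U)
  have := hp.epi
  have hq := hp.map R
  have := hq.epi
  obtain ⟨k, hk, -⟩ := hp.existsUnique (counitHom adj U) (counitHom_natural adj _)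
  have e : R.map k = i.hom := by rw [← cancel_epi (R.map p), ← R.map_comp, hk, hi]
  have : IsIso (R.map k) := by rw [e]; infer_instance
  have := isIso_of_reflects_iso k R
  refine ⟨counitHom_natural adj _, fun Z h hh => ?_⟩
  obtain ⟨l, hl, -⟩ := hp.existsUnique h hh
  refine ⟨inv k ≫ l, ?_, fun d hd => ?_⟩
  · dsimp only
    rw [← hk, Category.assoc, IsIso.hom_inv_id_assoc, hl]
  · rw [IsIso.eq_inv_comp, ← cancel_epi p, reassoc_of% hk, hl, hd]

theorem faithful_of_monadic (adj : G ⊣ R) : R.Faithful where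
  map_injective {X Y} f g h := by
    have := (isCoeq_counit adj X).epi
    rw [← cancel_epi (counitHom adj X), ← counitHom_natural, h, counitHom_natural]

/-- Fullness onto algebra morphisms: the transpose G f ≫ counit of f descends along the counit of X,
which is a coequalizer. -/
theorem exists_map_eq {X Y : D} (f : R.obj X ⟶ R.obj Y)
    (hf : R.map (counitHom adj X) ≫ f = R.map (G.map f) ≫ R.map (counitHom adj Y)) :
    ∃ g : X ⟶ Y, R.map g = f := by
  have hX := isCoeq_counit adj X
  have := (hX.map R).epi
  have w : G.map (R.map (counitHom adj X)) ≫ G.map f ≫ counitHom adj Y =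
      counitHom adj (G.obj (R.obj X)) ≫ G.map f ≫ counitHom adj Y := by
    rw [← G.map_comp_assoc, hf, G.map_comp_assoc, counitHom_natural, reassoc_of% counitHom_natural]
  refine ⟨hX.desc _ w, ?_⟩
  rw [← cancel_epi (R.map (counitHom adj X)), ← R.map_comp, hX.fac, R.map_comp, hf]

end Monadicity

/-! ### Modules over R(𝟙) as algebras, and R (X ⊗ U) as a relative tensor product. -/

section RelativeTensor

open Functor.LaxMonoidal

variable {C : Type u₁} [Category.{v₁} C] [MonoidalCategory C]
  {D : Type u₂} [Category.{v₂} D] [MonoidalCategory D]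
  {G : C ⥤ D} {R : D ⥤ C} [R.LaxMonoidal] (adj : G ⊣ R)

theorem lproj_counitHom (X Y : D) :
    lproj adj (R.obj Y) X ≫ R.map (counitHom adj Y ▷ X) = μ R Y X :=
  lproj_counit adj X Y

theorem rproj_counitHom (X Y : D) :
    rproj adj X (R.obj Y) ≫ R.map (X ◁ counitHom adj Y) = μ R X Y :=
  rproj_counit adj X Y

/-- The free left module `R(𝟙) ⊗ A` maps to `R G A`. -/
def freeL (A : C) : R.obj (𝟙_ D) ⊗ A ⟶ R.obj (G.obj A) :=
  rproj adj (𝟙_ D) A ≫ R.map (λ_ (G.obj A)).hom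

/-- The free right module `A ⊗ R(𝟙)` maps to `R G A`. -/
def freeR (A : C) : A ⊗ R.obj (𝟙_ D) ⟶ R.obj (G.obj A) :=
  lproj adj A (𝟙_ D) ≫ R.map (ρ_ (G.obj A)).hom

theorem freeL_eq (A : C) : freeL adj A = R.obj (𝟙_ D) ◁ unitHom adj A ≫ laxActL R (G.obj A) := by
  simp [freeL, rproj, laxActL]

theorem freeR_eq (A : C) : freeR adj A = unitHom adj A ▷ R.obj (𝟙_ D) ≫ laxActR R (G.obj A) := by
  simp [freeR, lproj, laxActR]

theorem freeL_counit (U : D) : freeL adj (R.obj U) ≫ R.map (counitHom adj U) = laxActL R U := by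
  rw [freeL, Category.assoc, ← R.map_comp, ← leftUnitor_naturality, R.map_comp,
    reassoc_of% rproj_counitHom, laxActL]

theorem freeR_counit (U : D) : freeR adj (R.obj U) ≫ R.map (counitHom adj U) = laxActR R U := by
  rw [freeR, Category.assoc, ← R.map_comp, ← rightUnitor_naturality, R.map_comp,
    reassoc_of% lproj_counitHom, laxActR]

/-- Together with `freeL_counit`, this rewrites the two legs of the canonical presentation of U,
tensored with X, as the two actions of R(𝟙) on R X ⊗ R U. -/
theorem freeL_μ (X : D) (A : C) :
    (α_ _ _ _).hom ≫ R.obj X ◁ freeL adj A ≫ μ R X (G.obj A) =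
      laxActR R X ▷ A ≫ rproj adj X A := by
  rw [rproj, ← whisker_exchange_assoc, laxActR_μ, freeL_eq, MonoidalCategory.whiskerLeft_comp]
  simp

theorem freeR_natural {A B : C} (f : A ⟶ B) :
    f ▷ R.obj (𝟙_ D) ≫ freeR adj B = freeR adj A ≫ R.map (G.map f) := by
  rw [freeR_eq, freeR_eq, Category.assoc, laxActR_natural, ← comp_whiskerRight_assoc,
    unitHom_natural, comp_whiskerRight_assoc]

theorem one_freeR (A : C) : A ◁ ε R ≫ freeR adj A = (ρ_ A).hom ≫ unitHom adj A := by
  rw [freeR_eq, whisker_exchange_assoc, one_laxActR, rightUnitor_naturality]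

/-- With `one_freeR` and `freeR_counit`, this makes `freeR` match the monad - ⊗ R(𝟙) with the monad
RG. -/
theorem freeR_laxActR (A : C) :
    freeR adj A ▷ R.obj (𝟙_ D) ≫ laxActR R (G.obj A) =
      (α_ _ _ _).hom ≫ A ◁ laxActR R (𝟙_ D) ≫ freeR adj A := by
  rw [freeR_eq, comp_whiskerRight, Category.assoc, laxActR_laxActR, whisker_exchange_assoc]
  simp

variable [ProjectionFormula adj]

instance (A : C) : IsIso (freeL adj A) := by unfold freeL; infer_instance
instance (A : C) : IsIso (freeR adj A) := by unfold freeR; infer_instance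

variable [ReflexiveMonoidal D] [PreservesReflexiveCoequalizers R] [R.ReflectsIsomorphisms]

/-- The lax structure of `R` exhibits `R (X ⊗ U)` as a relative tensor product over `R(𝟙)`. -/
theorem isCoeq_μ (adj : G ⊣ R) [ProjectionFormula adj] (X U : D) :
    IsCoeq (laxActR R X ▷ R.obj U) ((α_ _ _ _).hom ≫ R.obj X ◁ laxActL R U) (μ R X U) := by
  have hc := (((isCoeq_counit adj U).whiskerLeft X).map R)
  have := hc.epi
  refine ⟨by rw [laxActR_μ, Category.assoc], fun Z h hh => ?_⟩
  -- A balanced h, moved through the projection formula, coequalizes the image of the canonical pair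
  -- of U. Precomposing with `rproj` and then with R X ⊗ `freeL` turns this into the hypothesis on
  -- h.
  have w : R.map (X ◁ G.map (R.map (counitHom adj U))) ≫ inv (rproj adj X (R.obj U)) ≫ h =
      R.map (X ◁ counitHom adj (G.obj (R.obj U))) ≫ inv (rproj adj X (R.obj U)) ≫ h := by
    rw [← cancel_epi (rproj adj X (R.obj (G.obj (R.obj U)))), ← reassoc_of% rproj_natural_right,
      reassoc_of% rproj_counitHom, IsIso.hom_inv_id_assoc,
      ← cancel_epi (R.obj X ◁ freeL adj (R.obj U)), ← MonoidalCategory.whiskerLeft_comp_assoc,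
      freeL_counit, ← cancel_epi (α_ _ _ _).hom, reassoc_of% freeL_μ, IsIso.hom_inv_id_assoc, hh,
      Category.assoc]
  refine ⟨hc.desc _ w, ?_, fun d hd => ?_⟩
  · dsimp only
    rw [← rproj_counitHom adj, Category.assoc, hc.fac, IsIso.hom_inv_id_assoc]
  · rw [← cancel_epi (R.map (X ◁ counitHom adj U)), hc.fac, IsIso.eq_inv_comp,
      reassoc_of% rproj_counitHom]
    exact hd

instance isReflexivePair_μ (X U : D) :
    IsReflexivePair (laxActR R X ▷ R.obj U) ((α_ _ _ _).hom ≫ R.obj X ◁ laxActL R U) :=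
  IsReflexivePair.mk' ((ρ_ (R.obj X)).inv ▷ R.obj U ≫ (R.obj X ◁ ε R) ▷ R.obj U)
    (by simp only [← comp_whiskerRight, Category.assoc, one_laxActR]; simp)
    (by simp [← MonoidalCategory.whiskerLeft_comp, one_laxActL])

/-- Through the isomorphism `freeR`, R(𝟙)-linear maps are morphisms of RG-algebras. -/
theorem exists_map_eq_of_linear (adj : G ⊣ R) [ProjectionFormula adj] {X Y : D}
    (f : R.obj X ⟶ R.obj Y)
    (hf : laxActR R X ≫ f = f ▷ R.obj (𝟙_ D) ≫ laxActR R Y) : ∃ g : X ⟶ Y, R.map g = f := by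
  refine exists_map_eq adj f ?_
  rw [← cancel_epi (freeR adj (R.obj X)), reassoc_of% freeR_counit, ← reassoc_of% freeR_natural,
    freeR_counit, hf]

/-- The algebra structure is the inverse of `freeR` followed by the action; `h₃` and `h₄` are its
unit and associativity laws. -/
theorem exists_iso_of_module (adj : G ⊣ R) [ProjectionFormula adj] {A : C}
    {act : A ⊗ R.obj (𝟙_ D) ⟶ A}
    (h₁ : A ◁ ε R ≫ act = (ρ_ A).hom)
    (h₂ : act ▷ R.obj (𝟙_ D) ≫ act = (α_ _ _ _).hom ≫ A ◁ laxActR R (𝟙_ D) ≫ act) :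
    ∃ (X : D) (i : R.obj X ≅ A), laxActR R X ≫ i.hom = i.hom ▷ R.obj (𝟙_ D) ≫ act := by
  have h₃ : unitHom adj A ≫ inv (freeR adj A) ≫ act = 𝟙 A := by
    have h := one_freeR adj A
    rw [← IsIso.eq_comp_inv, Category.assoc] at h
    rw [← Category.assoc, ← cancel_epi (ρ_ A).hom, Category.assoc, ← reassoc_of% h, h₁,
      Category.comp_id]
  have h₄ : R.map (counitHom adj (G.obj A)) ≫ inv (freeR adj A) ≫ act =
      R.map (G.map (inv (freeR adj A) ≫ act)) ≫ inv (freeR adj A) ≫ act := by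
    rw [← cancel_epi (freeR adj (R.obj (G.obj A))), reassoc_of% freeR_counit,
      ← reassoc_of% freeR_natural, IsIso.hom_inv_id_assoc,
      ← cancel_epi (freeR adj A ▷ R.obj (𝟙_ D)), reassoc_of% freeR_laxActR,
      IsIso.hom_inv_id_assoc, comp_whiskerRight_assoc, ← comp_whiskerRight_assoc,
      IsIso.hom_inv_id, id_whiskerRight, Category.id_comp, h₂]
  obtain ⟨X, p, i, -, hp⟩ := exists_iso_of_algebra adj h₃ h₄
  have hi := algebra_iso_linear adj h₃ h₄ p i hp
  refine ⟨X, i, ?_⟩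
  rw [← freeR_counit adj, Category.assoc, hi, ← reassoc_of% freeR_natural, IsIso.hom_inv_id_assoc]

end RelativeTensor

/-- An isomorphism between the targets of two parallel pairs that interchanges the pairs induces
an isomorphism of coequalizers. -/
theorem IsCoeq.exists_iso_of_swap {C : Type u₁} [Category.{v₁} C] {A B Q A' B' Q' : C}
    {f g : A ⟶ B} {q : B ⟶ Q} {f' g' : A' ⟶ B'} {q' : B' ⟶ Q'} (hq : IsCoeq f g q)
    (hq' : IsCoeq f' g' q') (s : A ≅ A') (t : B ≅ B') (h₁ : f ≫ t.hom = s.hom ≫ g')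
    (h₂ : g ≫ t.hom = s.hom ≫ f') : ∃ e : Q ≅ Q', q ≫ e.hom = t.hom ≫ q' := by
  have := hq.epi
  have := hq'.epi
  obtain ⟨a, ha, -⟩ := hq.existsUnique (t.hom ≫ q')
    (by rw [reassoc_of% h₁, reassoc_of% h₂, hq'.w])
  have h₁' : g' ≫ t.inv = s.inv ≫ f := by
    rw [Iso.comp_inv_eq, Category.assoc, h₁, Iso.inv_hom_id_assoc]
  have h₂' : f' ≫ t.inv = s.inv ≫ g := by
    rw [Iso.comp_inv_eq, Category.assoc, h₂, Iso.inv_hom_id_assoc]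
  obtain ⟨b, hb, -⟩ := hq'.existsUnique (t.inv ≫ q)
    (by rw [reassoc_of% h₁', reassoc_of% h₂', hq.w])
  exact ⟨⟨a, b, by rw [← cancel_epi q, reassoc_of% ha, hb]; simp,
    by rw [← cancel_epi q', reassoc_of% hb, ha]; simp⟩, ha⟩

/-! ### Descending a local half-braiding from R X to X. -/

section LiftHalfBraiding

open Functor.LaxMonoidal

variable {C : Type u₁} [Category.{v₁} C] [MonoidalCategory C]
  {D : Type u₂} [Category.{v₂} D] [MonoidalCategory D] {R : D ⥤ C} [R.LaxMonoidal]
  (γ : ∀ A : C, R.obj (𝟙_ D) ⊗ A ≅ A ⊗ R.obj (𝟙_ D)) {X : D} (b : HalfBraiding (R.obj X))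

/-- The half-braidings permute the factors of `R X ⊗ R(𝟙) ⊗ R U`. -/
def swapIso (U : D) :
    (R.obj X ⊗ R.obj (𝟙_ D)) ⊗ R.obj U ≅ (R.obj U ⊗ R.obj (𝟙_ D)) ⊗ R.obj X :=
  α_ _ _ _ ≪≫ whiskerLeftIso _ (γ (R.obj U)) ≪≫ (α_ _ _ _).symm ≪≫
    whiskerRightIso (b.β (R.obj U)) _ ≪≫ α_ _ _ _ ≪≫ whiskerLeftIso _ (b.β (R.obj (𝟙_ D))) ≪≫
      (α_ _ _ _).symm

/-- The properties of a half-braiding on `R X` expressing that `R X` is a local module over the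
central monoid `R(𝟙)`, whose half-braiding is `γ`. -/
structure IsLocalHalfBraiding : Prop where
  laxActL_eq : ∀ U : D, (γ (R.obj U)).hom ≫ laxActR R U = laxActL R U
  act_comm : ∀ A : C, laxActR R X ▷ A ≫ (b.β A).hom =
    ((α_ _ _ _).hom ≫ R.obj X ◁ (γ A).hom ≫ (α_ _ _ _).inv ≫ (b.β A).hom ▷ R.obj (𝟙_ D) ≫
      (α_ _ _ _).hom) ≫ A ◁ laxActR R X
  isLocal : (b.β (R.obj (𝟙_ D))).hom ≫ laxActL R X = laxActR R X

namespace IsLocalHalfBraiding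

variable {γ b}

/-- Centrality of the action moves b past it, and locality replaces the right action on R X by b
followed by the left action. With `laxActL_comp`, b exchanges the two maps of the balancing pairs.
-/
theorem laxActR_comp (hb : IsLocalHalfBraiding γ b) (U : D) :
    laxActR R X ▷ R.obj U ≫ (b.β (R.obj U)).hom =
    (swapIso γ b U).hom ≫ (α_ _ _ _).hom ≫ R.obj U ◁ laxActL R X := by
  rw [hb.act_comm, ← hb.isLocal]
  simp [swapIso]

theorem laxActL_comp (hb : IsLocalHalfBraiding γ b) (U : D) :
    ((α_ _ _ _).hom ≫ R.obj X ◁ laxActL R U) ≫ (b.β (R.obj U)).hom =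
      (swapIso γ b U).hom ≫ laxActR R U ▷ R.obj X := by
  rw [← hb.laxActL_eq, MonoidalCategory.whiskerLeft_comp]
  simp [swapIso]

variable [ReflexiveMonoidal C] [ReflexiveMonoidal D] [PreservesReflexiveCoequalizers R]
  [R.ReflectsIsomorphisms] {G : C ⥤ D}

theorem exists_map_iso (hb : IsLocalHalfBraiding γ b) (adj : G ⊣ R) [ProjectionFormula adj]
    (U : D) : ∃ c : X ⊗ U ≅ U ⊗ X, μ R X U ≫ R.map c.hom = (b.β (R.obj U)).hom ≫ μ R U X := by
  have hX := isCoeq_μ adj X U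
  obtain ⟨e, he⟩ := hX.exists_iso_of_swap (isCoeq_μ adj U X) (swapIso γ b U)
    (b.β (R.obj U)) (hb.laxActR_comp U) (hb.laxActL_comp U)
  -- Linearity of e: R(𝟙) acts on the factor R U; after applying b, balancing turns this into the
  -- left action on R X, and locality identifies b at R(𝟙) followed by it with the right action.
  obtain ⟨c, hc⟩ := exists_map_eq_of_linear adj e.hom (by
    have := (hX.whiskerRight (R.obj (𝟙_ D))).epi
    rw [← cancel_epi (μ R X U ▷ R.obj (𝟙_ D)), reassoc_of% μ_laxActR, he,
      ← comp_whiskerRight_assoc, he, comp_whiskerRight_assoc, μ_laxActR,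
      HalfBraiding.naturality_assoc, laxActR_μ, HalfBraiding.monoidal]
    simp only [Category.assoc, Iso.inv_hom_id_assoc]
    rw [← MonoidalCategory.whiskerLeft_comp_assoc, hb.isLocal, Iso.hom_inv_id_assoc])
  have : IsIso (R.map c) := by rw [hc]; infer_instance
  have := isIso_of_reflects_iso c R
  exact ⟨asIso c, by rw [asIso_hom, hc, he]⟩

/-- The axioms for c follow from those for b, since `R` is faithful and the lax structure morphisms,
also after tensoring with R X, are epimorphisms. -/
theorem exists_halfBraiding (hb : IsLocalHalfBraiding γ b) (adj : G ⊣ R) [ProjectionFormula adj] :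
    ∃ c : HalfBraiding X, ∀ U, μ R X U ≫ R.map (c.β U).hom = (b.β (R.obj U)).hom ≫ μ R U X := by
  choose c hc using hb.exists_map_iso adj
  have := faithful_of_monadic adj
  refine ⟨⟨c, fun U V => ?_, fun {U V} f => ?_⟩, hc⟩
  · have := (isCoeq_μ adj X (U ⊗ V)).epi
    have := ((isCoeq_μ adj U V).whiskerLeft (R.obj X)).epi
    apply R.map_injective
    have h1 := congrArg (· ▷ R.obj V) (hc U)
    have h2 := congrArg (R.obj U ◁ ·) (hc V)
    simp only [comp_whiskerRight, MonoidalCategory.whiskerLeft_comp] at h1 h2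
    rw [← cancel_epi (μ R X (U ⊗ V)), ← cancel_epi (R.obj X ◁ μ R U V), hc,
      HalfBraiding.naturality_assoc, HalfBraiding.monoidal]
    simp only [R.map_comp, Category.assoc]
    rw [reassoc_of% μ_associator_inv, ← μ_natural_left_assoc, reassoc_of% h1, associativity_assoc,
      ← μ_natural_right_assoc, reassoc_of% h2, μ_associator_inv]
  · have := (isCoeq_μ adj X U).epi
    apply R.map_injective
    rw [← cancel_epi (μ R X U), R.map_comp, R.map_comp, ← μ_natural_right_assoc, hc,
      HalfBraiding.naturality_assoc, μ_natural_left, reassoc_of% hc]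

end IsLocalHalfBraiding

end LiftHalfBraiding

/-- Transport of a half-braiding along an isomorphism. -/
def transportHalfBraiding {C : Type u₁} [Category.{v₁} C] [MonoidalCategory C] {A A' : C}
    (i : A' ≅ A) (b : HalfBraiding A) : HalfBraiding A' where
  β U := whiskerRightIso i U ≪≫ b.β U ≪≫ (whiskerLeftIso U i).symm
  monoidal U V := by
    simp only [Iso.trans_hom, whiskerRightIso_hom, Iso.symm_hom, whiskerLeftIso_inv,
      HalfBraiding.monoidal, comp_whiskerRight, MonoidalCategory.whiskerLeft_comp, Category.assoc]
    monoidal_nf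
    simp
  naturality {U V} f := by
    simp only [Iso.trans_hom, whiskerRightIso_hom, Iso.symm_hom, whiskerLeftIso_inv,
      Category.assoc, whisker_exchange_assoc, HalfBraiding.naturality_assoc, whisker_exchange]

theorem transportHalfBraiding_comp {C : Type u₁} [Category.{v₁} C] [MonoidalCategory C] {A A' : C}
    (i : A' ≅ A) (b : HalfBraiding A) (U : C) :
    ((transportHalfBraiding i b).β U).hom ≫ U ◁ i.hom = i.hom ▷ U ≫ (b.β U).hom := by
  simp [transportHalfBraiding]

/-! ### The equivalence on Drinfeld centers. -/

section Center

variable {C : Type u₁} [Category.{v₁} C] [MonoidalCategory C]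
  {D : Type u₂} [Category.{v₂} D] [MonoidalCategory D]
  {G : C ⥤ D} {R : D ⥤ C} [R.LaxMonoidal] (adj : G ⊣ R) [ProjectionFormula adj]

/-- Naturality of b along the unit A ⟶ R G A reduces b at A to b at R G A, where `hc` applies;
invertibility of `lproj` makes this reduction faithful. -/
theorem inducedIso_eq {X : D} (b : HalfBraiding (R.obj X)) (c : HalfBraiding X)
    (hc : ∀ U, μ R X U ≫ R.map (c.β U).hom = (b.β (R.obj U)).hom ≫ μ R U X) (A : C) :
    (inducedIso adj c A).hom = (b.β A).hom := by
  rw [← cancel_mono (lproj adj A X), inducedIso_lproj, rproj, Category.assoc, hc,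
    HalfBraiding.naturality_assoc, lproj]

/-- The half-braiding on the unit object given by the unitors. -/
def unitHalfBraiding (D : Type u₂) [Category.{v₂} D] [MonoidalCategory D] :
    HalfBraiding (𝟙_ D) where
  β U := λ_ U ≪≫ (ρ_ U).symm

/-- The half-braiding of the central monoid `R(𝟙)`. -/
noncomputable def centralIso (A : C) : R.obj (𝟙_ D) ⊗ A ≅ A ⊗ R.obj (𝟙_ D) :=
  inducedIso adj (unitHalfBraiding D) A

theorem centralIso_laxActR (U : D) :
    (centralIso adj (R.obj U)).hom ≫ laxActR R U = laxActL R U := by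
  have h := induced_braided adj (unitHalfBraiding D) U
  rw [laxActR, centralIso, ← reassoc_of% h, ← R.map_comp]
  simp [unitHalfBraiding, laxActL]

/-- The hypotheses unpack a local module in the center into data in C: `hcomm` is centrality of the
action and `hloc` is locality. Naturality of the central half-braiding is the hypothesis `hnat`, as
the adjunction is not assumed monoidal here. -/
theorem isLocalHalfBraiding_transport {A : C} {b : HalfBraiding A} {act : A ⊗ R.obj (𝟙_ D) ⟶ A}
    (hcomm : ∀ B : C, act ▷ B ≫ (b.β B).hom =
      ((α_ _ _ _).hom ≫ A ◁ (centralIso adj B).hom ≫ (α_ _ _ _).inv ≫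
        (b.β B).hom ▷ R.obj (𝟙_ D) ≫ (α_ _ _ _).hom) ≫ B ◁ act)
    (hloc : (b.β (R.obj (𝟙_ D))).hom ≫ (centralIso adj A).hom ≫ act = act)
    (hnat : ∀ {B B' : C} (f : B ⟶ B'), R.obj (𝟙_ D) ◁ f ≫ (centralIso adj B').hom =
      (centralIso adj B).hom ≫ f ▷ R.obj (𝟙_ D))
    {X : D} (i : R.obj X ≅ A) (hi : laxActR R X ≫ i.hom = i.hom ▷ R.obj (𝟙_ D) ≫ act) :
    IsLocalHalfBraiding (centralIso adj) (transportHalfBraiding i b) where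
  laxActL_eq := centralIso_laxActR adj
  act_comm B := by
    have h1 := congrArg (· ▷ B) hi
    have h2 := congrArg (B ◁ ·) hi
    have h3 := congrArg (· ▷ R.obj (𝟙_ D)) (transportHalfBraiding_comp i b B)
    simp only [comp_whiskerRight, MonoidalCategory.whiskerLeft_comp] at h1 h2 h3
    rw [← cancel_mono (B ◁ i.hom), Category.assoc, transportHalfBraiding_comp, reassoc_of% h1,
      hcomm]
    simp only [Category.assoc]
    rw [h2, ← associator_naturality_middle_assoc, reassoc_of% h3, associator_naturality_left_assoc,
      ← whisker_exchange_assoc, associator_inv_naturality_left_assoc]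
  isLocal := by
    rw [← cancel_mono i.hom, Category.assoc, ← centralIso_laxActR adj, Category.assoc, hi,
      ← reassoc_of% hnat, reassoc_of% transportHalfBraiding_comp, hloc]

variable [G.LaxMonoidal] [IsMonoidalAdjunction adj] [ReflexiveMonoidal C] [ReflexiveMonoidal D]
  [PreservesReflexiveCoequalizers R] [R.ReflectsIsomorphisms]

theorem isCoeq_relμ_center (X Y : Center D) :
    IsCoeq (RMod.pairL ((toRMod (centerMap adj)).obj X) ((toRMod (centerMap adj)).obj Y))
      (RMod.pairR ((toRMod (centerMap adj)).obj X) ((toRMod (centerMap adj)).obj Y))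
      (relμ (centerMap adj) X Y) := by
  refine isCoeq_center _ _ _ ?_
  rw [RMod.pairR, toRMod_lact]
  exact isCoeq_μ adj X.1 Y.1

theorem full_toLocMod_center : (toLocMod (centerMap adj)).Full where
  map_surjective {X Y} f := by
    have := faithful_of_monadic adj
    let k : R.obj X.1 ⟶ R.obj Y.1 := f.hom.hom.f
    obtain ⟨g, hg⟩ := exists_map_eq_of_linear adj k (congrArg Center.Hom.f f.hom.comm)
    have hk (A : C) : k ▷ A ≫ (inducedIso adj Y.2 A).hom = (inducedIso adj X.2 A).hom ≫ A ◁ k :=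
      f.hom.hom.comm A
    refine ⟨⟨g, fun U => ?_⟩, ?_⟩
    -- After `R` and precomposition with μ, compatibility of g with the half-braidings becomes that
    -- of k with the induced ones, because the induced half-braidings at R U correspond through μ to
    -- the original ones at U.
    · have := (isCoeq_μ adj X.1 U).epi
      apply R.map_injective
      rw [← cancel_epi (μ R X.1 U), R.map_comp, R.map_comp, ← μ_natural_left_assoc,
        induced_braided adj, hg, reassoc_of% hk, reassoc_of% induced_braided adj X.2 U,
        ← μ_natural_right, hg]
    · apply ObjectProperty.hom_ext
      apply RMod.hom_ext
      apply Center.ext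
      exact hg

theorem faithful_toLocMod_center : (toLocMod (centerMap adj)).Faithful where
  map_injective {X Y} f g h := by
    have := faithful_of_monadic adj
    apply Center.ext
    apply R.map_injective
    exact congrArg (fun t => t.hom.hom.f) h

theorem essSurj_toLocMod_center : (toLocMod (centerMap adj)).EssSurj where
  mem_essImage N := by
    have h₁ : N.obj.X.1 ◁ ε R ≫ N.obj.act.f = (ρ_ N.obj.X.1).hom := by
      have h := N.obj.act_one
      rw [unitMon_one] at h
      exact congrArg Center.Hom.f h
    have h₂ : N.obj.act.f ▷ R.obj (𝟙_ D) ≫ N.obj.act.f =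
        (α_ _ _ _).hom ≫ N.obj.X.1 ◁ laxActR R (𝟙_ D) ≫ N.obj.act.f := by
      have h := N.obj.act_act
      rw [unitMon_mul] at h
      exact congrArg Center.Hom.f h
    obtain ⟨X, i, hi⟩ := exists_iso_of_module adj h₁ h₂
    obtain ⟨c, hc⟩ := (isLocalHalfBraiding_transport adj N.obj.act.comm
      (congrArg Center.Hom.f N.property)
      (inducedHalfBraiding adj (unitHalfBraiding D)).naturality i hi).exists_halfBraiding adj
    -- The isomorphism i is central for the transported half-braiding by construction, and c induces
    -- exactly that half-braiding.
    let j : (centerMap adj).obj ⟨X, c⟩ ⟶ N.obj.X := ⟨i.hom, fun U => by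
      refine (transportHalfBraiding_comp i N.obj.X.2 U).symm.trans ?_
      exact congrArg (· ≫ U ◁ i.hom) (inducedIso_eq adj _ c hc U).symm⟩
    have : IsIso j.f := inferInstanceAs (IsIso i.hom)
    let e := Center.isoMk j
    exact ⟨⟨X, c⟩, ⟨ObjectProperty.isoMk _ (RMod.isoMk (X := (toRMod (centerMap adj)).obj ⟨X, c⟩)
      ⟨j, Center.ext _ _ hi⟩ e.inv e.hom_inv_id e.inv_hom_id)⟩⟩

end Center

end MonoidalMonadicity

theorem mainTheorem12
    {C : Type u₁} [Category.{v₁} C] [MonoidalCategory C]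
    {D : Type u₂} [Category.{v₂} D] [MonoidalCategory D]
    [MonoidalMonadicity.ReflexiveMonoidal C] [MonoidalMonadicity.ReflexiveMonoidal D]
    (G : C ⥤ D) (R : D ⥤ C) [G.LaxMonoidal] [R.LaxMonoidal]
    [MonoidalMonadicity.PreservesReflexiveCoequalizers G]
    [MonoidalMonadicity.PreservesReflexiveCoequalizers R]
    (adj : G ⊣ R) [MonoidalMonadicity.IsMonoidalAdjunction adj]
    [MonoidalMonadicity.ProjectionFormula adj] [R.ReflectsIsomorphisms] :
    ∃ e : Center D ≌ MonoidalMonadicity.LocMod (MonoidalMonadicity.centralMonoid adj).X,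
      Nonempty e.functor.Braided := by
  let F := MonoidalMonadicity.toLocMod (MonoidalMonadicity.centerMap adj)
  have := MonoidalMonadicity.full_toLocMod_center adj
  have := MonoidalMonadicity.faithful_toLocMod_center adj
  have := MonoidalMonadicity.essSurj_toLocMod_center adj
  have : F.IsEquivalence := {}
  exact ⟨F.asEquivalence, MonoidalMonadicity.nonempty_braided_toLocMod
    (MonoidalMonadicity.centerMap adj) (MonoidalMonadicity.isCoeq_relμ_center adj)⟩
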